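/- Let $N\ge 2$. For an open set $E\subseteq\mathbb{R}^N$ let $C^\infty_0(E)$ be the set of smooth real functions whose support is a compact subset of $E$, and for a compact set $\Sigma\subseteq E$ let $$\mathrm{cap}_1(\Sigma;E)=\inf\Big\{\int_E|\nabla\varphi|\,dx\ :\ \varphi\in C^\infty_0(E),\ \varphi\ge 1\text{ on }\Sigma\Big\}.$$ For $0<\gamma<1$ and an open set $\Omega\subseteq\mathbb{R}^N$, the capacitary inradius $R_{1,\gamma}(\Omega)\in[0,+\infty]$ is the supremum of all $r>0$ for which there is $x_0\in\mathbb{R}^N$ with $$\mathrm{cap}_1\big(\overline{B_r(x_0)}\setminus\Omega;B_{2r}(x_0)\big)\le\gamma\,\mathrm{cap}_1\big(\overline{B_r(x_0)};B_{2r}(x_0)\big)$$ (and $R_{1,\gamma}(\Omega)=0$ if there is no such $r$). The Cheeger constant of $\Omega$ is $$h(\Omega)=\inf\Big\{\frac{\mathcal{H}^{N-1}(\partial E)}{|E|}\ :\ E\Subset\Omega\text{ nonempty open set with smooth boundary}\Big\}\in[0,+\infty],$$ with $h(\emptyset)=+\infty$. In what follows, $1/0=+\infty$ and $1/{+\infty}=0$.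 There are a constant $\sigma_{N,1}>0$, depending only on $N$, and, for every $0<\gamma<1$, a constant $C_{N,1,\gamma}>0$, depending only on $N$ and $\gamma$, such that for every $0<\gamma<1$ and every open set $\Omega\subseteq\mathbb{R}^N$ $$\sigma_{N,1}\,\gamma\,\frac{1}{R_{1,\gamma}(\Omega)}\le h(\Omega)\le C_{N,1,\gamma}\,\frac{1}{R_{1,\gamma}(\Omega)}.$$ The constant $C_{N,1,\gamma}$ diverges to $+\infty$ as $\gamma\nearrow 1$, and necessarily so: if constants $C'_\gamma$, $0<\gamma<1$, are such that $h(\Omega)\le C'_\gamma/R_{1,\gamma}(\Omega)$ for every $0<\gamma<1$ and every open set $\Omega\subseteq\mathbb{R}^N$, then $C'_\gamma\to+\infty$ as $\gamma\nearrow1$. In particular, for every open set $\Omega\subseteq\mathbb{R}^N$ and every $0<\gamma<1$, $$h(\Omega)>0\quad\Longleftrightarrow\quad R_{1,\gamma}(\Omega)<+\infty,$$ and the last condition does not depend on $0<\gamma<1$. -/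

import Mathlib

open Set Filter Topology MeasureTheory
open scoped ENNReal

namespace CapacitaryInradius

/-- The space `C₀^∞(E)`: smooth real functions on `ℝ^N` whose support is a compact subset
of `E`. -/
def testFunctions {N : ℕ} (E : Set (EuclideanSpace ℝ (Fin N))) :
    Set (EuclideanSpace ℝ (Fin N) → ℝ) :=
  {φ | ContDiff ℝ (⊤ : ℕ∞) φ ∧ HasCompactSupport φ ∧ tsupport φ ⊆ E}

/-- The `p`-capacity of `S` relative to `E` (meant for `E` open and `S ⊆ E` compact):
the infimum of `∫_E |∇φ|^p` over the test functions `φ` of `E` with `φ ≥ 1` on `S`. -/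
noncomputable def relCap {N : ℕ} (p : ℝ) (S E : Set (EuclideanSpace ℝ (Fin N))) : ℝ≥0∞ :=
  ⨅ φ ∈ {φ ∈ testFunctions E | ∀ x ∈ S, 1 ≤ φ x}, ∫⁻ x in E, ‖gradient φ x‖ₑ ^ p

/-- A compact set `S ⊆ closedBall x₀ r` is `(p, γ)`-negligible. -/
def IsNegligible {N : ℕ} (p γ : ℝ) (x₀ : EuclideanSpace ℝ (Fin N)) (r : ℝ)
    (S : Set (EuclideanSpace ℝ (Fin N))) : Prop :=
  IsCompact S ∧ S ⊆ Metric.closedBall x₀ r ∧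
    relCap p S (Metric.ball x₀ (2 * r)) ≤
      ENNReal.ofReal γ * relCap p (Metric.closedBall x₀ r) (Metric.ball x₀ (2 * r))

/-- The capacitary inradius `R_{p,γ}(Ω)`, with values in `[0, +∞]`. -/
noncomputable def capInradius {N : ℕ} (p γ : ℝ) (Ω : Set (EuclideanSpace ℝ (Fin N))) : ℝ≥0∞ :=
  ⨆ r ∈ {r : ℝ | 0 < r ∧ ∃ x₀, IsNegligible p γ x₀ r (Metric.closedBall x₀ r \ Ω)},
    ENNReal.ofReal r

/-- `E` has smooth boundary: near every boundary point, `E` is the sublevel set `{f < 0}` of a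
smooth function `f` which vanishes at that point and has nonzero gradient there. -/
def HasSmoothBoundary {N : ℕ} (E : Set (EuclideanSpace ℝ (Fin N))) : Prop :=
  ∀ x ∈ frontier E, ∃ U : Set (EuclideanSpace ℝ (Fin N)), IsOpen U ∧ x ∈ U ∧
    ∃ f : EuclideanSpace ℝ (Fin N) → ℝ, ContDiffOn ℝ (⊤ : ℕ∞) f U ∧ f x = 0 ∧ gradient f x ≠ 0 ∧
      E ∩ U = {y ∈ U | f y < 0}

/-- The sets competing in the definition of the Cheeger constant of `Ω`: the nonempty open sets
with smooth boundary whose closure is a compact subset of `Ω`. -/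
def cheegerSets {N : ℕ} (Ω : Set (EuclideanSpace ℝ (Fin N))) :
    Set (Set (EuclideanSpace ℝ (Fin N))) :=
  {E | IsOpen E ∧ E.Nonempty ∧ IsCompact (closure E) ∧ closure E ⊆ Ω ∧ HasSmoothBoundary E}

/-- The Cheeger constant `h(Ω)`, with values in `[0, +∞]` (it is `+∞` for `Ω = ∅`).
Here `μHE[N - 1]` is the Hausdorff measure `ℋ^{N-1}`, normalized so as to agree with the
Lebesgue measure on `(N-1)`-dimensional Euclidean space. -/
noncomputable def cheegerConstant {N : ℕ} (Ω : Set (EuclideanSpace ℝ (Fin N))) : ℝ≥0∞ :=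
  ⨅ E ∈ cheegerSets Ω,
    (μHE[N - 1] : Measure (EuclideanSpace ℝ (Fin N))) (frontier E) / volume E

end CapacitaryInradius

/-! Lower bound for `h`. If no ball of radius `r` has `γ`-negligible complement, test the capacity
of `closedBall y r \ Ω` with `η (1 - u / u y)`. Up to dimensional constants this bounds `γ |u y|` by
the mean of `|u x - u y| + r |∇u x|` over `B_{2r}(y)`. Integrating in `y`, and controlling the
increments of `u` by its total variation, gives a Poincaré inequality with constant of order `r / γ`
(`exists_poincare_const`). Applied to the indicator of a competitor `G`, cut off by bumps on a cover
of `∂G` by small balls, it yields `|G| ≲ (r / γ) ℋ^{N-1}(∂G)`; only the definition of Hausdorff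
measure is used, not the regularity of `∂G`.

Upper bound for `h`. The field `x / max r ‖x‖` calibrates the ball, so `cap_1` of a closed ball is
exactly `(N / r) |B_r|`, and `(N / r) ∫_{B_r} |φ| ≤ ∫ |∇φ|` holds with the same constant. This
sharpness is what lets every `γ < 1` be reached: if the complement of `Ω` in `B_r` is
`γ`-negligible, a nearly optimal `φ` has mean below some `γ' < 1` on `B_r`, hence stays away from
`1` on a fixed fraction of the ball. The function `η (1 - φ)`, with `η` a cutoff, is positive only
inside `Ω`, has total variation `≲ |B_r| / r`, and has a superlevel set of volume `≳ |B_r|`. A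
coarea inequality picks a level set of small measure. Smoothness of the boundary is arranged by a
small linear perturbation: its critical points on a compact set are finite in number, so almost
every level is regular, by the equidimensional Sard lemma applied to the gradient.

Divergence of the constant. For the shell `γ < ‖x‖ < 2 - γ` the part of the unit ball left out has
relative capacity `γ^(N-1) ≤ γ`, so the inradius is at least `1`, whereas the Poincaré constant is
at most the width `2 (1 - γ)` and `h` is at least of order `1 / (1 - γ)`. -/

namespace CapacitaryInradius

/-! ### Increments of `C¹` functions and cutoffs at every scale -/

section Calculus

variable {E : Type*} [NormedAddCommGroup E] [InnerProductSpace ℝ E] [FiniteDimensional ℝ E]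
  [MeasurableSpace E] [BorelSpace E]

/-- The `L¹` norm of the increment of a `C¹` function is controlled by its total variation. -/
theorem lintegral_enorm_translate_sub_le {φ : E → ℝ} (hφ : ContDiff ℝ 1 φ) (h : E) :
    ∫⁻ x, ‖φ (x + h) - φ x‖ₑ ≤ ‖h‖ₑ * ∫⁻ x, ‖fderiv ℝ φ x‖ₑ := by
  have hcont : Continuous (fderiv ℝ φ) := hφ.continuous_fderiv one_ne_zero
  -- Fundamental theorem of calculus along the segment from `x` to `x + h`; Tonelli and translation
  -- invariance do the rest.
  have hpt : ∀ x, ‖φ (x + h) - φ x‖ₑ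
      ≤ ∫⁻ t in Ioc (0 : ℝ) 1, ‖h‖ₑ * ‖fderiv ℝ φ (x + t • h)‖ₑ := by
    intro x
    have hder : ∀ t ∈ uIcc (0 : ℝ) 1, HasDerivAt (fun t : ℝ => φ (x + t • h))
        (fderiv ℝ φ (x + t • h) h) t := by
      intro t _
      have h1 : HasDerivAt (fun t : ℝ => x + t • h) h t := by
        simpa using ((hasDerivAt_id t).smul_const h).const_add x
      exact ((hφ.differentiable one_ne_zero _).hasFDerivAt).comp_hasDerivAt t h1
    have hc : Continuous fun t : ℝ => fderiv ℝ φ (x + t • h) h := by fun_prop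
    have := intervalIntegral.integral_eq_sub_of_hasDerivAt hder (hc.intervalIntegrable 0 1)
    simp only [one_smul, zero_smul, add_zero] at this
    rw [← this, intervalIntegral.integral_of_le zero_le_one]
    refine (enorm_integral_le_lintegral_enorm _).trans (lintegral_mono fun t => ?_)
    rw [mul_comm]
    exact ContinuousLinearMap.le_opENorm _ _
  calc ∫⁻ x, ‖φ (x + h) - φ x‖ₑ
      ≤ ∫⁻ x, ∫⁻ t in Ioc (0 : ℝ) 1, ‖h‖ₑ * ‖fderiv ℝ φ (x + t • h)‖ₑ := lintegral_mono hpt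
    _ = ∫⁻ t in Ioc (0 : ℝ) 1, ∫⁻ x, ‖h‖ₑ * ‖fderiv ℝ φ (x + t • h)‖ₑ := by
        apply lintegral_lintegral_swap
        have : Continuous fun p : E × ℝ => ‖h‖ₑ * ‖fderiv ℝ φ (p.1 + p.2 • h)‖ₑ := by
          refine ENNReal.continuous_const_mul enorm_ne_top |>.comp ?_
          exact continuous_enorm.comp (hcont.comp (by fun_prop))
        exact this.measurable.aemeasurable
    _ = ∫⁻ t in Ioc (0 : ℝ) 1, ‖h‖ₑ * ∫⁻ x, ‖fderiv ℝ φ x‖ₑ := by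
        refine lintegral_congr fun t => ?_
        rw [lintegral_const_mul' _ _ enorm_ne_top,
          lintegral_add_right_eq_self (fun x => ‖fderiv ℝ φ x‖ₑ) (t • h)]
    _ = ‖h‖ₑ * ∫⁻ x, ‖fderiv ℝ φ x‖ₑ := by simp

/-- Smooth cutoff functions between concentric balls, with a scale-invariant gradient bound. -/
theorem exists_cutoff (E : Type*) [NormedAddCommGroup E] [InnerProductSpace ℝ E]
    [FiniteDimensional ℝ E] {a b : ℝ} (ha : 0 < a) (hab : a < b) :
    ∃ L : ℝ, 0 < L ∧ ∀ (x₀ : E) (r : ℝ), 0 < r → ∃ η : E → ℝ, ContDiff ℝ (⊤ : ℕ∞) η ∧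
      (∀ x, η x ∈ Icc (0 : ℝ) 1) ∧ (∀ x ∈ Metric.closedBall x₀ (a * r), η x = 1) ∧
      HasCompactSupport η ∧
      tsupport η ⊆ Metric.ball x₀ (b * r) ∧ ∀ x, ‖fderiv ℝ η x‖ ≤ L / r := by
  -- The outer radius lies strictly below `b`, so the closed support fits in the open ball. All
  -- cutoffs are rescalings of this single bump, hence the common `L`.
  let f : ContDiffBump (0 : E) := ⟨a, (a + b) / 2, ha, by linarith⟩
  have hf : ContDiff ℝ (⊤ : ℕ∞) f := f.contDiff
  obtain ⟨L, hL⟩ := (f.hasCompactSupport.fderiv (𝕜 := ℝ)).exists_bound_of_continuous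
    (hf.continuous_fderiv (by simp))
  refine ⟨max L 1, by positivity, fun x₀ r hr => ?_⟩
  have hdiff : ContDiff ℝ (⊤ : ℕ∞) fun x : E => r⁻¹ • (x - x₀) := by fun_prop
  have hts : tsupport (fun x => f (r⁻¹ • (x - x₀))) ⊆ Metric.closedBall x₀ ((a + b) / 2 * r) := by
    refine closure_minimal ?_ Metric.isClosed_closedBall
    intro x hx
    have : r⁻¹ • (x - x₀) ∈ Function.support f := hx
    rw [f.support_eq, mem_ball_zero_iff, norm_smul, norm_inv, Real.norm_of_nonneg hr.le,
      inv_mul_lt_iff₀ hr] at this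
    rw [Metric.mem_closedBall, dist_eq_norm]
    change ‖x - x₀‖ < r * ((a + b) / 2) at this
    linarith
  refine ⟨fun x => f (r⁻¹ • (x - x₀)), hf.comp hdiff, fun x => ⟨f.nonneg, f.le_one⟩, ?_, ?_, ?_, ?_⟩
  · intro x hx
    apply f.one_of_mem_closedBall
    rw [Metric.mem_closedBall, dist_eq_norm] at hx
    rw [mem_closedBall_zero_iff, norm_smul, norm_inv, Real.norm_of_nonneg hr.le,
      inv_mul_le_iff₀ hr]
    change ‖x - x₀‖ ≤ r * a
    linarith
  · exact (isCompact_closedBall _ _).of_isClosed_subset (isClosed_tsupport _) hts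
  · refine hts.trans (Metric.closedBall_subset_ball ?_)
    nlinarith
  · intro x
    have h1 : HasFDerivAt (fun x : E => r⁻¹ • (x - x₀)) (r⁻¹ • ContinuousLinearMap.id ℝ E) x :=
      ((hasFDerivAt_id x).sub_const x₀).const_smul r⁻¹
    have h2 := ((hf.differentiable (by simp) (r⁻¹ • (x - x₀))).hasFDerivAt).comp x h1
    have h3 : fderiv ℝ (fun x => f (r⁻¹ • (x - x₀))) x
      = r⁻¹ • fderiv ℝ f (r⁻¹ • (x - x₀)) := by
      rw [show (fun x => f (r⁻¹ • (x - x₀))) = f ∘ (fun x : E => r⁻¹ • (x - x₀)) from rfl,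
        h2.fderiv]
      ext y
      simp
    rw [h3, norm_smul, norm_inv, Real.norm_of_nonneg hr.le, div_eq_inv_mul]
    gcongr
    exact (hL _).trans (le_max_left _ _)

end Calculus

/-! ### The calibrating field of a ball -/

section Calibration

variable {E : Type*} [NormedAddCommGroup E] [InnerProductSpace ℝ E]

/-- The radial field `x / max r ‖x‖`, a calibration of the ball of radius `r`. -/
noncomputable def radialField (r : ℝ) (x : E) : E := (max r ‖x‖)⁻¹ • x

theorem norm_radialField_le {r : ℝ} (hr : 0 < r) (x : E) : ‖radialField r x‖ ≤ 1 := by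
  have : 0 < max r ‖x‖ := lt_max_of_lt_left hr
  rw [radialField, norm_smul, norm_inv, Real.norm_of_nonneg this.le, inv_mul_le_iff₀ this, mul_one]
  exact le_max_right _ _

/-- The field has a kink on the sphere of radius `r`; Lipschitz continuity is the regularity under
which it can be integrated by parts. -/
theorem lipschitzWith_radialField {r : ℝ} (hr : 0 < r) :
    LipschitzWith (Real.toNNReal (2 / r)) (radialField r : E → E) := by
  refine LipschitzWith.of_dist_le' fun x y => ?_
  rw [dist_eq_norm, dist_eq_norm]
  have hx : 0 < max r ‖x‖ := lt_max_of_lt_left hr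
  have hy : 0 < max r ‖y‖ := lt_max_of_lt_left hr
  have hdecomp : radialField r x - radialField r y
      = (max r ‖x‖)⁻¹ • ((x - y) + (max r ‖y‖ - max r ‖x‖) • radialField r y) := by
    simp only [radialField, smul_add, smul_sub, smul_smul, sub_smul, sub_mul]
    rw [mul_inv_cancel₀ hy.ne', inv_mul_cancel_left₀ hx.ne', mul_one]
    abel
  have hmax : |max r ‖y‖ - max r ‖x‖| ≤ ‖x - y‖ := by
    refine (abs_max_sub_max_le_max r ‖y‖ r ‖x‖).trans ?_
    rw [sub_self, abs_zero, norm_sub_rev]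
    exact max_le (norm_nonneg _) (abs_norm_sub_norm_le _ _)
  rw [hdecomp, norm_smul, norm_inv, Real.norm_of_nonneg hx.le, div_mul_eq_mul_div, div_eq_inv_mul]
  have h1 : ‖(x - y) + (max r ‖y‖ - max r ‖x‖) • radialField r y‖ ≤ 2 * ‖x - y‖ := by
    refine (norm_add_le _ _).trans ?_
    rw [norm_smul, Real.norm_eq_abs]
    nlinarith [norm_radialField_le hr y, norm_nonneg (radialField r y), norm_nonneg (x - y),
      abs_nonneg (max r ‖y‖ - max r ‖x‖)]
  have h2 : (max r ‖x‖)⁻¹ ≤ r⁻¹ := inv_anti₀ hr (le_max_left _ _)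
  gcongr

/-- The divergence of `radialField r`. -/
noncomputable def radialDiv (E : Type*) [NormedAddCommGroup E] [InnerProductSpace ℝ E]
    (r : ℝ) (x : E) : ℝ :=
  if ‖x‖ < r then Module.finrank ℝ E / r else (Module.finrank ℝ E - 1) / ‖x‖

theorem lineDeriv_inner_radialField_of_lt {r : ℝ} {x e : E} (hx : ‖x‖ < r) :
    lineDeriv ℝ (fun y => inner ℝ e (radialField r y)) x e = ‖e‖ ^ 2 / r := by
  have hev : ∀ᶠ y in 𝓝 x, inner ℝ e (radialField r y) = r⁻¹ * inner ℝ e y := by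
    filter_upwards [continuous_norm.continuousAt.eventually_lt continuousAt_const hx] with y hy
    rw [radialField, max_eq_left hy.le, inner_smul_right]
  rw [Filter.EventuallyEq.lineDeriv_eq hev]
  have : HasFDerivAt (fun y : E => r⁻¹ * inner ℝ e y) (r⁻¹ • innerSL ℝ e) x :=
    ((innerSL ℝ e).hasFDerivAt (x := x)).const_mul r⁻¹
  rw [(this.hasLineDerivAt e).lineDeriv]
  simp
  ring

theorem lineDeriv_inner_radialField_of_gt {r : ℝ} (hr : 0 < r) {x e : E} (hx : r < ‖x‖) :
    lineDeriv ℝ (fun y => inner ℝ e (radialField r y)) x e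
      = (‖e‖ ^ 2 - inner ℝ e x ^ 2 / ‖x‖ ^ 2) / ‖x‖ := by
  have hx0 : x ≠ 0 := norm_pos_iff.1 (hr.trans hx)
  have hev : ∀ᶠ y in 𝓝 x, inner ℝ e (radialField r y) = ‖y‖⁻¹ * inner ℝ e y := by
    filter_upwards [continuousAt_const.eventually_lt continuous_norm.continuousAt hx] with y hy
    rw [radialField, max_eq_right hy.le, inner_smul_right]
  rw [Filter.EventuallyEq.lineDeriv_eq hev, lineDeriv]
  have h1 : HasDerivAt (fun t : ℝ => x + t • e) e 0 := by
    simpa using ((hasDerivAt_id (0 : ℝ)).smul_const e).const_add x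
  have h2 : HasDerivAt (fun t : ℝ => ‖x + t • e‖ ^ 2) (2 * inner ℝ x e) 0 := by
    simpa using h1.norm_sq
  have h3 : HasDerivAt (fun t : ℝ => Real.sqrt (‖x + t • e‖ ^ 2))
      (2 * inner ℝ x e / (2 * ‖x‖)) 0 := by
    convert! h2.sqrt (by simpa using hx0) using 2
    simp
  have h3' : HasDerivAt (fun t : ℝ => ‖x + t • e‖) (2 * inner ℝ x e / (2 * ‖x‖)) 0 := by
    simpa using h3
  have h4 : HasDerivAt (fun t : ℝ => inner ℝ e (x + t • e)) (inner ℝ e e) 0 :=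
    ((innerSL ℝ e).hasFDerivAt).comp_hasDerivAt 0 h1
  have h5 := (h3'.inv (by simpa using hx0)).mul h4
  have hxn : ‖x‖ ≠ 0 := norm_ne_zero_iff.2 hx0
  convert! h5.deriv using 1
  simp only [zero_smul, add_zero, real_inner_self_eq_norm_sq, Pi.inv_apply]
  rw [real_inner_comm x e]
  field_simp
  ring

end Calibration

/-! ### Divergence of the calibrating field -/

section RadialDivergence

variable {E : Type*} [NormedAddCommGroup E] [InnerProductSpace ℝ E]

theorem lineDeriv_abs {φ : E → ℝ} (hφ : Differentiable ℝ φ) (x v : E) :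
    lineDeriv ℝ (fun y => |φ y|) x v = SignType.sign (φ x) * fderiv ℝ φ x v := by
  have hline : HasLineDerivAt ℝ φ (fderiv ℝ φ x v) x v := (hφ x).hasFDerivAt.hasLineDerivAt v
  rcases lt_trichotomy (φ x) 0 with hx | hx | hx
  · have hev : (fun y => |φ y|) =ᶠ[𝓝 x] fun y => -φ y := by
      filter_upwards [hφ.continuous.continuousAt.eventually_lt continuousAt_const hx] with y hy
      exact abs_of_neg hy
    rw [hev.lineDeriv_eq, ((hφ x).hasFDerivAt.fun_neg.hasLineDerivAt v).lineDeriv]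
    simp [sign_neg hx]
  -- At a zero of `φ` the restriction of `|φ|` to the line has a minimum, so its `deriv` is `0`, by
  -- Fermat or as the default value at a corner. This agrees with `sign 0 = 0`.
  · have hmin : IsLocalMin (fun t : ℝ => |φ (x + t • v)|) 0 := by
      refine Filter.Eventually.of_forall fun t => ?_
      simp [hx]
    rw [lineDeriv, hmin.deriv_eq_zero]
    simp [hx]
  · have hev : (fun y => |φ y|) =ᶠ[𝓝 x] φ := by
      filter_upwards [continuousAt_const.eventually_lt hφ.continuous.continuousAt hx] with y hy
      exact abs_of_pos hy
    rw [hev.lineDeriv_eq, hline.lineDeriv]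
    simp [sign_pos hx]

/-- Outside the ball the derivative of `x / ‖x‖` is the projection orthogonal to `x` divided by
`‖x‖`, and Parseval gives its trace `(N - 1) / ‖x‖`. -/
theorem sum_lineDeriv_inner_radialField {ι : Type*} [Fintype ι] (b : OrthonormalBasis ι ℝ E)
    {r : ℝ} (hr : 0 < r) {x : E} (hx : ‖x‖ ≠ r) :
    ∑ i, lineDeriv ℝ (fun y => inner ℝ (b i) (radialField r y)) x (b i) = radialDiv E r x := by
  have hcard : (Fintype.card ι : ℝ) = Module.finrank ℝ E := by
    rw [Module.finrank_eq_card_basis b.toBasis]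
  rw [radialDiv]
  split_ifs with h
  · simp_rw [lineDeriv_inner_radialField_of_lt h]
    simp [hcard]
    ring
  · have h' : r < ‖x‖ := lt_of_le_of_ne (not_lt.1 h) hx.symm
    have hx0 : ‖x‖ ≠ 0 := (hr.trans h').ne'
    simp_rw [lineDeriv_inner_radialField_of_gt hr h']
    rw [← Finset.sum_div, Finset.sum_sub_distrib, ← Finset.sum_div, b.sum_sq_inner_right]
    simp [hcard, hx0]

theorem measurable_radialDiv [MeasurableSpace E] [BorelSpace E] (r : ℝ) :
    Measurable (radialDiv E r) :=
  Measurable.ite (measurableSet_lt measurable_norm measurable_const) measurable_const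
    (measurable_const.div measurable_norm)

theorem radialDiv_nonneg [FiniteDimensional ℝ E] [Nontrivial E] {r : ℝ} (hr : 0 < r) (x : E) :
    0 ≤ radialDiv E r x := by
  have : (1 : ℝ) ≤ Module.finrank ℝ E := by exact_mod_cast Module.finrank_pos (R := ℝ) (M := E)
  rw [radialDiv]
  split_ifs
  · positivity
  · exact div_nonneg (by linarith) (norm_nonneg _)

theorem radialDiv_le [FiniteDimensional ℝ E] [Nontrivial E] {r : ℝ} (hr : 0 < r) (x : E) :
    radialDiv E r x ≤ Module.finrank ℝ E / r := by
  have : (1 : ℝ) ≤ Module.finrank ℝ E := by exact_mod_cast Module.finrank_pos (R := ℝ) (M := E)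
  rw [radialDiv]
  split_ifs with h
  · exact le_rfl
  · push Not at h
    gcongr
    linarith

end RadialDivergence

/-! ### Integration by parts against the field -/

section CalibrationIdentity

variable {E : Type*} [NormedAddCommGroup E] [InnerProductSpace ℝ E] [FiniteDimensional ℝ E]
  [MeasurableSpace E] [BorelSpace E]

theorem abs_sign_mul_le (y a : ℝ) : |((SignType.sign y : SignType) : ℝ) * a| ≤ |a| := by
  rcases lt_trichotomy y 0 with h | h | h <;> simp [h, sign_neg, sign_pos]

theorem measurable_coe_sign : Measurable fun y : ℝ => ((SignType.sign y : SignType) : ℝ) := by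
  have : (fun y : ℝ => ((SignType.sign y : SignType) : ℝ))
      = fun y => if 0 < y then 1 else if y < 0 then -1 else 0 := by
    ext y
    rw [sign_apply]
    split_ifs <;> simp
  rw [this]
  exact Measurable.ite measurableSet_Ioi measurable_const
    (Measurable.ite measurableSet_Iio measurable_const measurable_const)

theorem integrable_sign_mul_fderiv {φ : E → ℝ} (hφ : ContDiff ℝ 1 φ) (hc : HasCompactSupport φ)
    {X : E → E} (hX : Continuous X) :
    Integrable fun x => SignType.sign (φ x) * fderiv ℝ φ x (X x) := by
  have hfX : Continuous fun x => fderiv ℝ φ x (X x) :=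
    (hφ.continuous_fderiv one_ne_zero).clm_apply hX
  have hi : Integrable fun x => fderiv ℝ φ x (X x) := by
    refine hfX.integrable_of_hasCompactSupport ?_
    refine (hc.fderiv ℝ).mono fun x hx h => hx ?_
    simp only [h, zero_apply]
  exact hi.mono ((measurable_coe_sign.comp hφ.continuous.measurable).mul
    hfX.measurable).aestronglyMeasurable (Eventually.of_forall fun x => abs_sign_mul_le _ _)

/-- Integration by parts of `|φ|` against the radial field. -/
theorem integral_abs_mul_radialDiv {φ : E → ℝ} (hφ : ContDiff ℝ 1 φ) (hc : HasCompactSupport φ)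
    {r : ℝ} (hr : 0 < r) :
    ∫ x, |φ x| * radialDiv E r x
      = -∫ x, SignType.sign (φ x) * fderiv ℝ φ x (radialField r x) := by
  rcases subsingleton_or_nontrivial E with hE | hE
  · have h1 : ∀ x : E, radialDiv E r x = 0 := fun x => by
      have : ‖x‖ < r := by rwa [Subsingleton.elim x 0, norm_zero]
      simp [radialDiv, this, Module.finrank_zero_of_subsingleton]
    have h2 : ∀ x : E, radialField r x = 0 := fun x => Subsingleton.elim _ _
    simp [h1, h2]
  -- The divergence theorem is applied one coordinate at a time: the components `P i` and `|φ|` are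
  -- Lipschitz, and `|φ|` has compact support.
  let b := stdOrthonormalBasis ℝ E
  let P : Fin (Module.finrank ℝ E) → E → ℝ := fun i y => inner ℝ (b i) (radialField r y)
  have hdiff : Differentiable ℝ φ := hφ.differentiable one_ne_zero
  have hfc : Continuous (fderiv ℝ φ) := hφ.continuous_fderiv one_ne_zero
  obtain ⟨C, hC⟩ := hφ.lipschitzWith_of_hasCompactSupport hc one_ne_zero
  have habs : LipschitzWith C fun y => |φ y| := by
    simpa [Function.comp_def] using lipschitzWith_one_norm.comp hC
  have habsc : HasCompactSupport fun y => |φ y| := hc.norm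
  have hPlip : ∀ i, LipschitzWith (‖innerSL ℝ (b i)‖₊ * Real.toNNReal (2 / r)) (P i) := fun i =>
    (innerSL ℝ (b i)).lipschitz.comp (lipschitzWith_radialField hr)
  have hparts : ∀ i, ∫ x, lineDeriv ℝ (P i) x (b i) * |φ x|
      = -∫ x, (SignType.sign (φ x) * fderiv ℝ φ x (b i)) * P i x := fun i => by
    rw [(hPlip i).integral_lineDeriv_mul_eq habs habsc (b i), ← integral_neg]
    refine integral_congr_ae (Eventually.of_forall fun x => ?_)
    simp only [lineDeriv_abs hdiff, map_neg]
    ring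
  have hintegral_div : ∀ i, Integrable fun x => lineDeriv ℝ (P i) x (b i) * |φ x| := fun i => by
    have hm : MemLp (fun x => lineDeriv ℝ (P i) x (b i)) ∞ (volume : Measure E) :=
      (hPlip i).memLp_lineDeriv (b i)
    have hi : Integrable fun x => |φ x| :=
      (habs.continuous).integrable_of_hasCompactSupport habsc
    have := (memLp_one_iff_integrable.2 hi).mul (r := 1) hm
    exact memLp_one_iff_integrable.1 this
  have hintegral_grad : ∀ i, Integrable
      fun x => (SignType.sign (φ x) * fderiv ℝ φ x (b i)) * P i x := by
    intro i
    have h := integrable_sign_mul_fderiv hφ hc ((hPlip i).continuous.smul continuous_const)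
      (X := fun x => P i x • b i)
    refine h.congr (Eventually.of_forall fun x => ?_)
    simp only [map_smul, smul_eq_mul]
    ring
  calc ∫ x, |φ x| * radialDiv E r x = ∫ x, ∑ i, lineDeriv ℝ (P i) x (b i) * |φ x| := by
        refine integral_congr_ae ?_
        -- The divergence formula fails only on the sphere, a null set.
        have hae : ∀ᵐ x : E, x ∉ Metric.sphere (0 : E) r :=
          measure_eq_zero_iff_ae_notMem.1 (Measure.addHaar_sphere _ _ _)
        filter_upwards [hae] with x hx
        rw [← Finset.sum_mul, sum_lineDeriv_inner_radialField b hr (by simpa using hx), mul_comm]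
    _ = -∑ i, ∫ x, (SignType.sign (φ x) * fderiv ℝ φ x (b i)) * P i x := by
        rw [integral_finsetSum _ fun i _ => hintegral_div i,
          Finset.sum_congr rfl fun i _ => hparts i,
          Finset.sum_neg_distrib]
    _ = -∫ x, SignType.sign (φ x) * fderiv ℝ φ x (radialField r x) := by
        rw [← integral_finsetSum _ fun i _ => hintegral_grad i]
        congr 1
        refine integral_congr_ae (Eventually.of_forall fun x => ?_)
        simp only [P, mul_assoc]
        rw [← Finset.mul_sum]
        congr 1
        conv_rhs => rw [← b.sum_repr' (radialField r x), map_sum]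
        refine Finset.sum_congr rfl fun i _ => ?_
        rw [map_smul, smul_eq_mul, mul_comm]

theorem integrable_abs_mul_radialDiv [Nontrivial E] {φ : E → ℝ} (hφ : Continuous φ)
    (hc : HasCompactSupport φ) {r : ℝ} (hr : 0 < r) :
    Integrable fun x => |φ x| * radialDiv E r x := by
  have hi : Integrable φ := hφ.integrable_of_hasCompactSupport hc
  refine hi.abs.mul_bdd (c := Module.finrank ℝ E / r) (measurable_radialDiv r).aestronglyMeasurable
    (Eventually.of_forall fun x => ?_)
  rw [Real.norm_of_nonneg (radialDiv_nonneg hr x)]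
  exact radialDiv_le hr x

theorem integrable_norm_fderiv {φ : E → ℝ} (hφ : ContDiff ℝ 1 φ) (hc : HasCompactSupport φ) :
    Integrable fun x => ‖fderiv ℝ φ x‖ :=
  ((hφ.continuous_fderiv one_ne_zero).integrable_of_hasCompactSupport (hc.fderiv ℝ)).norm

/-- The sharp inequality `(N / r) ∫_{B_r} |φ| ≤ ∫ |∇φ|`. -/
theorem mul_setLIntegral_ball_le [Nontrivial E] {φ : E → ℝ} (hφ : ContDiff ℝ 1 φ)
    (hc : HasCompactSupport φ) (x₀ : E) {r : ℝ} (hr : 0 < r) :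
    ENNReal.ofReal (Module.finrank ℝ E / r) * ∫⁻ x in Metric.ball x₀ r, ‖φ x‖ₑ
      ≤ ∫⁻ x, ‖fderiv ℝ φ x‖ₑ := by
  have centered : ∀ ψ : E → ℝ, ContDiff ℝ 1 ψ → HasCompactSupport ψ →
      ENNReal.ofReal (Module.finrank ℝ E / r) * ∫⁻ x in Metric.ball (0 : E) r, ‖ψ x‖ₑ
        ≤ ∫⁻ x, ‖fderiv ℝ ψ x‖ₑ := by
    intro ψ hψ hψc
    -- Calibration: the field has norm at most `1`. Its divergence is `N / r` in the ball and
    -- nonnegative outside, so the exterior part is dropped below.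
    have hreal : ∫ x, |ψ x| * radialDiv E r x ≤ ∫ x, ‖fderiv ℝ ψ x‖ := by
      rw [integral_abs_mul_radialDiv hψ hψc hr]
      refine (neg_le_abs _).trans ((abs_integral_le_integral_abs).trans ?_)
      refine integral_mono_of_nonneg (Eventually.of_forall fun x => abs_nonneg _)
        (integrable_norm_fderiv hψ hψc) (Eventually.of_forall fun x => ?_)
      refine (abs_sign_mul_le _ _).trans (((fderiv ℝ ψ x).le_opNorm _).trans ?_)
      exact mul_le_of_le_one_right (norm_nonneg _) (norm_radialField_le hr x)
    have h1 := ENNReal.ofReal_le_ofReal hreal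
    rw [ofReal_integral_eq_lintegral_ofReal (integrable_abs_mul_radialDiv hψ.continuous hψc hr)
        (Eventually.of_forall fun x => mul_nonneg (abs_nonneg _) (radialDiv_nonneg hr x)),
      ofReal_integral_eq_lintegral_ofReal (integrable_norm_fderiv hψ hψc)
        (Eventually.of_forall fun x => norm_nonneg _)] at h1
    simp_rw [ofReal_norm] at h1
    refine le_trans ?_ h1
    rw [← lintegral_const_mul' _ _ ENNReal.ofReal_ne_top]
    refine (setLIntegral_mono' Metric.isOpen_ball.measurableSet fun x hx => ?_).trans
      (setLIntegral_le_lintegral (Metric.ball 0 r) _)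
    have hx' : ‖x‖ < r := by simpa using hx
    rw [ENNReal.ofReal_mul (abs_nonneg _), mul_comm, radialDiv, if_pos hx', ← Real.norm_eq_abs,
      ofReal_norm]
  have h := centered (fun x => φ (x + x₀)) (hφ.comp (by fun_prop))
    (hc.comp_homeomorph (Homeomorph.addRight x₀))
  have h2 : ∫⁻ x in Metric.ball (0 : E) r, ‖φ (x + x₀)‖ₑ = ∫⁻ x in Metric.ball x₀ r, ‖φ x‖ₑ := by
    rw [← lintegral_indicator Metric.isOpen_ball.measurableSet,
      ← lintegral_indicator Metric.isOpen_ball.measurableSet,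
      ← lintegral_add_right_eq_self ((Metric.ball x₀ r).indicator fun x => ‖φ x‖ₑ) x₀]
    refine lintegral_congr fun x => ?_
    simp [indicator, dist_eq_norm]
  have h3 : ∫⁻ x, ‖fderiv ℝ (fun x => φ (x + x₀)) x‖ₑ = ∫⁻ x, ‖fderiv ℝ φ x‖ₑ := by
    simp_rw [fderiv_comp_add_right]
    exact lintegral_add_right_eq_self (fun x => ‖fderiv ℝ φ x‖ₑ) x₀
  rwa [h2, h3] at h

end CalibrationIdentity

/-! ### Almost optimal functions for the capacity of a ball -/

section BallCapacity

variable {E : Type*} [NormedAddCommGroup E] [InnerProductSpace ℝ E] [FiniteDimensional ℝ E]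
  [MeasurableSpace E] [BorelSpace E]

/-- Radially decreasing test functions that are almost optimal for the `1`-capacity of a ball. -/
theorem exists_radial_cutoff [Nontrivial E] {ρ ρ' : ℝ} (hρ : 0 < ρ) (hρ' : ρ < ρ') :
    ∃ φ : E → ℝ, ContDiff ℝ (⊤ : ℕ∞) φ ∧ (∀ x ∈ Metric.closedBall 0 ρ, φ x = 1) ∧
      tsupport φ ⊆ Metric.closedBall 0 ρ' ∧
      ∫⁻ x, ‖fderiv ℝ φ x‖ₑ
        ≤ ENNReal.ofReal (Module.finrank ℝ E / ρ) * volume (Metric.closedBall (0 : E) ρ') := by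
  have hd : 0 < ρ' ^ 2 - ρ ^ 2 := by nlinarith
  -- A profile in the variable `‖x‖ ^ 2`, so that the radial function is smooth at the origin as
  -- well.
  let g : ℝ → ℝ := fun t => Real.smoothTransition ((ρ' ^ 2 - t) / (ρ' ^ 2 - ρ ^ 2))
  have hg : ContDiff ℝ (⊤ : ℕ∞) g := Real.smoothTransition.contDiff.comp (by fun_prop)
  have hganti : Antitone g := fun s t hst => Real.smoothTransition.monotone (by gcongr)
  have hg1 : ∀ t ≤ ρ ^ 2, g t = 1 := fun t ht =>
    Real.smoothTransition.one_of_one_le (by rw [le_div_iff₀ hd]; linarith)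
  have hg0 : ∀ t, ρ' ^ 2 ≤ t → g t = 0 := fun t ht =>
    Real.smoothTransition.zero_of_nonpos (div_nonpos_of_nonpos_of_nonneg (by linarith) hd.le)
  have hgle : ∀ t, g t ≤ 1 := fun t => Real.smoothTransition.le_one _
  have hgnn : ∀ t, 0 ≤ g t := fun t => Real.smoothTransition.nonneg _
  let φ : E → ℝ := fun x => g (‖x‖ ^ 2)
  have hφ : ContDiff ℝ (⊤ : ℕ∞) φ := hg.comp (contDiff_norm_sq ℝ)
  have hts : tsupport φ ⊆ Metric.closedBall 0 ρ' := by
    refine closure_minimal (fun x hx => ?_) Metric.isClosed_closedBall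
    by_contra hx'
    rw [mem_closedBall_zero_iff, not_le] at hx'
    exact hx (hg0 _ (by have := hρ.trans hρ'; gcongr))
  have hc : HasCompactSupport φ :=
    (isCompact_closedBall _ _).of_isClosed_subset (isClosed_tsupport _) hts
  have hφ1 : ContDiff ℝ 1 φ := hφ.of_le (by exact_mod_cast le_top)
  have hder : ∀ x, HasFDerivAt φ (deriv g (‖x‖ ^ 2) • (2 : ℝ) • innerSL ℝ x) x := fun x => by
    have h1 : HasDerivAt g (deriv g (‖x‖ ^ 2)) (‖x‖ ^ 2) :=
      (hg.differentiable (by simp) _).hasDerivAt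
    have h2 : HasFDerivAt (fun x : E => ‖x‖ ^ 2) ((2 : ℝ) • innerSL ℝ x) x := by
      simpa [two_smul] using (hasStrictFDerivAt_norm_sq x).hasFDerivAt
    exact h1.comp_hasFDerivAt x h2
  -- Equality case of the calibration: `φ` decreases radially, so its gradient is antiparallel to
  -- the field outside `B_ρ`, and it is constant inside.
  have hradial : ∀ x, ‖fderiv ℝ φ x‖
      = -(SignType.sign (φ x) * fderiv ℝ φ x (radialField ρ x)) := by
    intro x
    rcases eq_or_ne (φ x) 0 with hx0 | hx0
    · have : IsLocalMin φ x := Eventually.of_forall fun y => by rw [hx0]; exact hgnn _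
      simp [this.fderiv_eq_zero]
    have hpos : 0 < φ x := lt_of_le_of_ne (hgnn _) hx0.symm
    rw [sign_pos hpos]
    rcases le_or_gt ‖x‖ ρ with hx | hx
    · have : IsLocalMax φ x := Eventually.of_forall fun y => by
        rw [show φ x = 1 from hg1 _ (by gcongr)]; exact hgle _
      simp [this.fderiv_eq_zero]
    · have hxn : ‖x‖ ≠ 0 := (hρ.trans hx).ne'
      have hneg : deriv g (‖x‖ ^ 2) ≤ 0 := hganti.deriv_nonpos
      rw [(hder x).fderiv, radialField, max_eq_right hx.le]
      simp only [norm_smul, Real.norm_eq_abs, abs_of_nonpos hneg, innerSL_apply_norm, map_smul,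
        _root_.smul_apply, innerSL_apply_apply, real_inner_self_eq_norm_sq, smul_eq_mul,
        SignType.coe_one, abs_two]
      field_simp
  refine ⟨φ, hφ, fun x hx => hg1 _ ?_, hts, ?_⟩
  · rw [mem_closedBall_zero_iff] at hx
    gcongr
  have hintegral := integrable_abs_mul_radialDiv hφ.continuous hc hρ
  have hreal : ∫ x, ‖fderiv ℝ φ x‖ = ∫ x, |φ x| * radialDiv E ρ x := by
    rw [integral_abs_mul_radialDiv hφ1 hc hρ, ← integral_neg]
    exact integral_congr_ae (Eventually.of_forall hradial)
  have h1 := congrArg ENNReal.ofReal hreal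
  rw [ofReal_integral_eq_lintegral_ofReal hintegral
      (Eventually.of_forall fun x => mul_nonneg (abs_nonneg _) (radialDiv_nonneg hρ x)),
    ofReal_integral_eq_lintegral_ofReal (integrable_norm_fderiv hφ1 hc)
      (Eventually.of_forall fun x => norm_nonneg _)] at h1
  simp_rw [ofReal_norm] at h1
  rw [h1, ← setLIntegral_const]
  rw [← lintegral_indicator Metric.isClosed_closedBall.measurableSet]
  refine lintegral_mono fun x => ?_
  by_cases hx : x ∈ Metric.closedBall 0 ρ'
  · rw [indicator_of_mem hx]
    refine ENNReal.ofReal_le_ofReal ?_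
    calc |φ x| * radialDiv E ρ x ≤ 1 * radialDiv E ρ x := by
          gcongr
          · exact radialDiv_nonneg hρ x
          · rw [abs_of_nonneg (hgnn _)]; exact hgle _
      _ ≤ _ := by rw [one_mul]; exact radialDiv_le hρ x
  · rw [indicator_of_notMem hx, image_eq_zero_of_notMem_tsupport fun h => hx (hts h)]
    simp

end BallCapacity

/-! ### The `1`-capacity of a ball -/

section RelativeCapacity

variable {N : ℕ}

theorem enorm_gradient {F : Type*} [NormedAddCommGroup F] [InnerProductSpace ℝ F] [CompleteSpace F]
    (φ : F → ℝ) (x : F) : ‖gradient φ x‖ₑ = ‖fderiv ℝ φ x‖ₑ := by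
  rw [gradient, LinearIsometryEquiv.enorm_map]

theorem setLIntegral_enorm_fderiv {F : Type*} [NormedAddCommGroup F] [NormedSpace ℝ F]
    [MeasureSpace F] {φ : F → ℝ} {U : Set F} (hU : tsupport φ ⊆ U) :
    ∫⁻ x in U, ‖fderiv ℝ φ x‖ₑ = ∫⁻ x, ‖fderiv ℝ φ x‖ₑ := by
  refine setLIntegral_eq_of_support_subset fun x hx => ?_
  refine hU (support_fderiv_subset ℝ fun h => hx ?_)
  change ‖fderiv ℝ φ x‖ₑ = 0
  rw [← ofReal_norm, h, norm_zero, ENNReal.ofReal_zero]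

theorem relCap_one (S U : Set (EuclideanSpace ℝ (Fin N))) :
    relCap 1 S U = ⨅ φ ∈ {φ ∈ testFunctions U | ∀ x ∈ S, 1 ≤ φ x}, ∫⁻ x, ‖fderiv ℝ φ x‖ₑ := by
  rw [relCap]
  refine iInf_congr fun φ => iInf_congr fun hφ => ?_
  simp_rw [enorm_gradient, ENNReal.rpow_one]
  exact setLIntegral_enorm_fderiv hφ.1.2.2

theorem relCap_one_le {S U : Set (EuclideanSpace ℝ (Fin N))} {φ : EuclideanSpace ℝ (Fin N) → ℝ}
    (hφ : φ ∈ testFunctions U) (h1 : ∀ x ∈ S, 1 ≤ φ x) :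
    relCap 1 S U ≤ ∫⁻ x, ‖fderiv ℝ φ x‖ₑ := by
  rw [relCap_one]
  exact iInf₂_le φ ⟨hφ, h1⟩

theorem contDiff_one_of_mem_testFunctions {U : Set (EuclideanSpace ℝ (Fin N))}
    {φ : EuclideanSpace ℝ (Fin N) → ℝ} (hφ : φ ∈ testFunctions U) : ContDiff ℝ 1 φ :=
  hφ.1.of_le (by exact_mod_cast le_top)

/-- Admissible functions are at least `1` on the ball, so the calibration inequality applies
directly; the ambient set plays no role. -/
theorem mul_volume_ball_le_relCap [NeZero N] (x₀ : EuclideanSpace ℝ (Fin N)) {r : ℝ} (hr : 0 < r)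
    (U : Set (EuclideanSpace ℝ (Fin N))) :
    ENNReal.ofReal (N / r) * volume (Metric.ball x₀ r) ≤ relCap 1 (Metric.closedBall x₀ r) U := by
  rw [relCap_one]
  refine le_iInf₂ fun φ hφ => ?_
  have h := mul_setLIntegral_ball_le (contDiff_one_of_mem_testFunctions hφ.1) hφ.1.2.1 x₀ hr
  rw [finrank_euclideanSpace_fin] at h
  refine le_trans ?_ h
  gcongr
  rw [← setLIntegral_one]
  refine setLIntegral_mono' Metric.isOpen_ball.measurableSet fun x hx => ?_
  have : 1 ≤ φ x := hφ.2 x (Metric.ball_subset_closedBall hx)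
  rw [← ofReal_norm, Real.norm_of_nonneg (by linarith)]
  simpa using this

/-- Let the outer radius of the radial cutoffs decrease to `ρ`. The bound matches the one from
below, so the capacity is known exactly. -/
theorem relCap_closedBall_le [NeZero N] (x₀ : EuclideanSpace ℝ (Fin N)) {ρ s : ℝ} (hρ : 0 < ρ)
    (hs : ρ < s) :
    relCap 1 (Metric.closedBall x₀ ρ) (Metric.ball x₀ s)
      ≤ ENNReal.ofReal (N / ρ) * volume (Metric.ball x₀ ρ) := by
  have key : ∀ ρ' ∈ Ioo ρ s, relCap 1 (Metric.closedBall x₀ ρ) (Metric.ball x₀ s)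
      ≤ ENNReal.ofReal (N / ρ) * (ENNReal.ofReal (ρ' ^ N) *
        volume (Metric.ball (0 : EuclideanSpace ℝ (Fin N)) 1)) := by
    intro ρ' hρ'
    obtain ⟨φ, hφ, h1, hts, hle⟩ :=
      exists_radial_cutoff (E := EuclideanSpace ℝ (Fin N)) hρ hρ'.1
    rw [finrank_euclideanSpace_fin, Measure.addHaar_closedBall _ _ (hρ.trans hρ'.1).le,
      finrank_euclideanSpace_fin] at hle
    have hts' : tsupport (fun x => φ (x - x₀)) ⊆ Metric.closedBall x₀ ρ' := by
      refine closure_minimal (fun x hx => ?_) Metric.isClosed_closedBall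
      have := hts (subset_tsupport _ hx)
      simpa [dist_eq_norm] using this
    refine (relCap_one_le (φ := fun x => φ (x - x₀)) ⟨hφ.comp (by fun_prop), ?_, ?_⟩ ?_).trans ?_
    · exact (isCompact_closedBall _ _).of_isClosed_subset (isClosed_tsupport _) hts'
    · exact hts'.trans (Metric.closedBall_subset_ball hρ'.2)
    · intro x hx
      rw [h1 (x - x₀)]
      simpa [dist_eq_norm] using hx
    · simp_rw [fderiv_comp_sub]
      rwa [lintegral_sub_right_eq_self (fun x => ‖fderiv ℝ φ x‖ₑ) x₀]
  rw [Measure.addHaar_ball _ _ hρ.le, finrank_euclideanSpace_fin]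
  have hlim : Tendsto (fun ρ' : ℝ => ENNReal.ofReal (N / ρ) * (ENNReal.ofReal (ρ' ^ N) *
      volume (Metric.ball (0 : EuclideanSpace ℝ (Fin N)) 1))) (𝓝[>] ρ)
      (𝓝 (ENNReal.ofReal (N / ρ) * (ENNReal.ofReal (ρ ^ N) *
      volume (Metric.ball (0 : EuclideanSpace ℝ (Fin N)) 1)))) := by
    refine ENNReal.Tendsto.const_mul (ENNReal.Tendsto.mul_const ?_ (Or.inr measure_ball_lt_top.ne))
      (Or.inr ENNReal.ofReal_ne_top)
    refine (ENNReal.continuous_ofReal.tendsto _).comp ?_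
    exact ((continuous_pow N).tendsto ρ).mono_left nhdsWithin_le_nhds
  exact ge_of_tendsto hlim (mem_of_superset (Ioo_mem_nhdsGT hs) key)

end RelativeCapacity

/-! ### From capacity to a Poincaré inequality -/

section Poincare

variable {N : ℕ}

/-- Testing the capacity of `closedBall y r \ Ω` with a truncation of `1 - u / u y`. -/
theorem enorm_mul_relCap_le {L r : ℝ} {y : EuclideanSpace ℝ (Fin N)}
    {η : EuclideanSpace ℝ (Fin N) → ℝ} (hη : ContDiff ℝ (⊤ : ℕ∞) η)
    (hη01 : ∀ x, η x ∈ Icc (0 : ℝ) 1) (hη1 : ∀ x ∈ Metric.closedBall y r, η x = 1)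
    (hηc : HasCompactSupport η) (hηs : tsupport η ⊆ Metric.ball y (2 * r))
    (hηL : ∀ x, ‖fderiv ℝ η x‖ ≤ L / r)
    {Ω : Set (EuclideanSpace ℝ (Fin N))} {u : EuclideanSpace ℝ (Fin N) → ℝ}
    (hu : u ∈ testFunctions Ω) :
    ‖u y‖ₑ * relCap 1 (Metric.closedBall y r \ Ω) (Metric.ball y (2 * r))
      ≤ ∫⁻ x in Metric.ball y (2 * r),
          (ENNReal.ofReal (L / r) * ‖u x - u y‖ₑ + ‖fderiv ℝ u x‖ₑ) := by
  rcases eq_or_ne (u y) 0 with h0 | h0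
  · simp [h0]
  set c := u y with hcdef
  -- On `closedBall y r \ Ω` one has `u = 0` and `η = 1`, so `ψ = c` there and `c⁻¹ * ψ` is
  -- admissible.
  let ψ : EuclideanSpace ℝ (Fin N) → ℝ := fun x => η x * (c - u x)
  have hψ : ContDiff ℝ (⊤ : ℕ∞) ψ := hη.mul (contDiff_const.sub hu.1)
  have hψs : tsupport ψ ⊆ tsupport η := tsupport_mul_subset_left
  have hφ : (fun x => c⁻¹ * ψ x) ∈ testFunctions (Metric.ball y (2 * r)) := by
    have hs : tsupport (fun x => c⁻¹ * ψ x) ⊆ tsupport η :=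
      (tsupport_mul_subset_right (f := fun _ => c⁻¹)).trans hψs
    exact ⟨contDiff_const.mul hψ, hηc.of_isClosed_subset (isClosed_tsupport _) hs, hs.trans hηs⟩
  have hcap := relCap_one_le (S := Metric.closedBall y r \ Ω) hφ fun x hx => by
    have hux : u x = 0 := image_eq_zero_of_notMem_tsupport fun h => hx.2 (hu.2.2 h)
    simp [ψ, hη1 x hx.1, hux, h0]
  have hfd : ∀ x, fderiv ℝ (fun x => c⁻¹ * ψ x) x = c⁻¹ • fderiv ℝ ψ x := fun x =>
    fderiv_const_mul (hψ.differentiable (by simp) x) _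
  simp_rw [hfd, enorm_smul] at hcap
  rw [lintegral_const_mul' _ _ enorm_ne_top] at hcap
  have hcancel : ‖c‖ₑ * ‖c⁻¹‖ₑ = 1 := by
    rw [← enorm_mul, mul_inv_cancel₀ h0]; simp
  calc ‖c‖ₑ * relCap 1 (Metric.closedBall y r \ Ω) (Metric.ball y (2 * r))
      ≤ ‖c‖ₑ * (‖c⁻¹‖ₑ * ∫⁻ x, ‖fderiv ℝ ψ x‖ₑ) := by gcongr
    _ = ∫⁻ x, ‖fderiv ℝ ψ x‖ₑ := by rw [← mul_assoc, hcancel, one_mul]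
    _ = ∫⁻ x in Metric.ball y (2 * r), ‖fderiv ℝ ψ x‖ₑ := by
        exact (setLIntegral_enorm_fderiv (hψs.trans hηs)).symm
    _ ≤ _ := by
        refine lintegral_mono fun x => ?_
        have hux := hu.1.differentiable (by simp) x
        have h1 : fderiv ℝ ψ x = η x • (-fderiv ℝ u x) + (c - u x) • fderiv ℝ η x := by
          have h := fderiv_fun_mul (hη.differentiable (by simp) x) (hux.const_sub c)
          rwa [fderiv_const_sub] at h
        have h2 : ‖fderiv ℝ ψ x‖ ≤ L / r * ‖u x - c‖ + ‖fderiv ℝ u x‖ := by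
          rw [h1]
          refine (norm_add_le _ _).trans ?_
          rw [norm_smul, norm_smul, norm_neg, add_comm, norm_sub_rev, mul_comm]
          have := hη01 x
          rw [Real.norm_of_nonneg this.1]
          refine add_le_add (mul_le_mul_of_nonneg_right (hηL x) (norm_nonneg _)) ?_
          exact mul_le_of_le_one_left (norm_nonneg _) this.2
        have hL : 0 ≤ L / r := (norm_nonneg _).trans (hηL x)
        rw [← ofReal_norm (fderiv ℝ ψ x), ← ofReal_norm (u x - c), ← ofReal_norm (fderiv ℝ u x),
          ← ENNReal.ofReal_mul hL, ← ENNReal.ofReal_add (by positivity) (by positivity)]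
        exact ENNReal.ofReal_le_ofReal h2

/-- If no ball of radius `r` has a negligible intersection with the complement of `Ω`, then the
functions supported in `Ω` satisfy a Poincaré inequality at scale `r`. -/
theorem exists_poincare_const (N : ℕ) [NeZero N] : ∃ K : ℝ, 0 < K ∧
    ∀ (γ r : ℝ) (Ω : Set (EuclideanSpace ℝ (Fin N))), 0 < γ → 0 < r →
      (∀ x₀, ENNReal.ofReal γ * relCap 1 (Metric.closedBall x₀ r) (Metric.ball x₀ (2 * r))
        ≤ relCap 1 (Metric.closedBall x₀ r \ Ω) (Metric.ball x₀ (2 * r))) →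
      ∀ u ∈ testFunctions Ω,
        ENNReal.ofReal γ * ∫⁻ x, ‖u x‖ₑ ≤ ENNReal.ofReal (K * r) * ∫⁻ x, ‖fderiv ℝ u x‖ₑ := by
  obtain ⟨L, hL, hcut⟩ := exists_cutoff (EuclideanSpace ℝ (Fin N)) one_pos one_lt_two
  have hN : (0 : ℝ) < N := Nat.cast_pos.2 (Nat.pos_of_ne_zero (NeZero.ne N))
  -- `2 ^ N` is the volume ratio of `B_{2r}` and `B_r`; `2 * L + 1` is `(L / r) * (2 * r)` from the
  -- increments plus `1` from the gradient; `N` comes from the capacity of the ball.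
  refine ⟨2 ^ N * (2 * L + 1) / N, by positivity, fun γ r Ω hγ hr hcap u hu => ?_⟩
  have hu1 : ContDiff ℝ 1 u := contDiff_one_of_mem_testFunctions hu
  have hfc : Continuous (fderiv ℝ u) := hu1.continuous_fderiv one_ne_zero
  set V := volume (Metric.ball (0 : EuclideanSpace ℝ (Fin N)) r) with hV
  have hV0 : V ≠ 0 := (Metric.measure_ball_pos _ _ hr).ne'
  have hVt : V ≠ ⊤ := measure_ball_lt_top.ne
  set D := ∫⁻ x, ‖fderiv ℝ u x‖ₑ with hD
  -- The substitution `x = y + h` makes the domain of integration independent of `y`, so that the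
  -- order of integration can be exchanged afterwards.
  have hpt : ∀ y, ENNReal.ofReal γ * (ENNReal.ofReal (N / r) * V) * ‖u y‖ₑ
      ≤ ∫⁻ h in Metric.ball (0 : EuclideanSpace ℝ (Fin N)) (2 * r),
          (ENNReal.ofReal (L / r) * ‖u (y + h) - u y‖ₑ + ‖fderiv ℝ u (y + h)‖ₑ) := by
    intro y
    obtain ⟨η, h1, h2, h3, h4, h5, h6⟩ := hcut y r hr
    rw [one_mul] at h3
    have h7 := mul_volume_ball_le_relCap y hr (Metric.ball y (2 * r))
    rw [Measure.addHaar_ball_center] at h7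
    calc ENNReal.ofReal γ * (ENNReal.ofReal (N / r) * V) * ‖u y‖ₑ
        ≤ relCap 1 (Metric.closedBall y r \ Ω) (Metric.ball y (2 * r)) * ‖u y‖ₑ := by
          gcongr
          exact (by gcongr : _ ≤ _).trans (hcap y)
      _ ≤ ∫⁻ x in Metric.ball y (2 * r),
          (ENNReal.ofReal (L / r) * ‖u x - u y‖ₑ + ‖fderiv ℝ u x‖ₑ) := by
          rw [mul_comm]
          exact enorm_mul_relCap_le h1 h2 h3 h4 h5 h6 hu
      _ = _ := by
          rw [← lintegral_indicator Metric.isOpen_ball.measurableSet,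
            ← lintegral_indicator Metric.isOpen_ball.measurableSet,
            ← lintegral_add_left_eq_self _ y]
          refine lintegral_congr fun x => ?_
          simp [indicator, dist_eq_norm]
  have hmeas : Continuous fun p : EuclideanSpace ℝ (Fin N) × EuclideanSpace ℝ (Fin N) =>
      ENNReal.ofReal (L / r) * ‖u (p.1 + p.2) - u p.1‖ₑ + ‖fderiv ℝ u (p.1 + p.2)‖ₑ := by
    have huc := hu1.continuous
    have h1 : Continuous fun p : EuclideanSpace ℝ (Fin N) × EuclideanSpace ℝ (Fin N) =>
        ‖u (p.1 + p.2) - u p.1‖ₑ := continuous_enorm.comp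
      ((huc.comp (continuous_fst.add continuous_snd)).sub (huc.comp continuous_fst))
    have h2 : Continuous fun p : EuclideanSpace ℝ (Fin N) × EuclideanSpace ℝ (Fin N) =>
        ‖fderiv ℝ u (p.1 + p.2)‖ₑ :=
      continuous_enorm.comp (hfc.comp (continuous_fst.add continuous_snd))
    exact ((ENNReal.continuous_const_mul ENNReal.ofReal_ne_top).comp h1).add h2
  have hintegral : ENNReal.ofReal γ * (ENNReal.ofReal (N / r) * V) * ∫⁻ y, ‖u y‖ₑ
      ≤ ENNReal.ofReal (2 ^ N) * V * (ENNReal.ofReal (2 * L + 1) * D) := by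
    rw [← lintegral_const_mul' _ _ (by finiteness)]
    refine (lintegral_mono hpt).trans ?_
    rw [lintegral_lintegral_swap hmeas.measurable.aemeasurable]
    have hle : ∀ h ∈ Metric.ball (0 : EuclideanSpace ℝ (Fin N)) (2 * r),
        ∫⁻ y, (ENNReal.ofReal (L / r) * ‖u (y + h) - u y‖ₑ + ‖fderiv ℝ u (y + h)‖ₑ)
          ≤ ENNReal.ofReal (2 * L + 1) * D := by
      intro h hh
      have hh' : ‖h‖ₑ ≤ ENNReal.ofReal (2 * r) := by
        rw [← ofReal_norm]
        exact ENNReal.ofReal_le_ofReal (mem_ball_zero_iff.1 hh).le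
      have hm : Measurable fun y => ‖fderiv ℝ u (y + h)‖ₑ :=
        (continuous_enorm.comp (hfc.comp (continuous_add_const h))).measurable
      rw [lintegral_add_right _ hm,
        lintegral_const_mul' _ _ ENNReal.ofReal_ne_top,
        lintegral_add_right_eq_self (fun x => ‖fderiv ℝ u x‖ₑ) h,
        ENNReal.ofReal_add (by positivity) zero_le_one, ENNReal.ofReal_one, add_mul, one_mul]
      refine add_le_add_left ?_ _
      calc ENNReal.ofReal (L / r) * ∫⁻ y, ‖u (y + h) - u y‖ₑ
          ≤ ENNReal.ofReal (L / r) * (ENNReal.ofReal (2 * r) * D) := by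
            gcongr
            exact (lintegral_enorm_translate_sub_le hu1 h).trans (by gcongr)
        _ = ENNReal.ofReal (2 * L) * D := by
            rw [← mul_assoc, ← ENNReal.ofReal_mul (by positivity)]
            congr 2
            field_simp
    refine (setLIntegral_mono' Metric.isOpen_ball.measurableSet hle).trans ?_
    rw [setLIntegral_const, Measure.addHaar_ball_mul_of_pos _ _ two_pos,
      finrank_euclideanSpace_fin, mul_comm]
  have hscale : ENNReal.ofReal (r / N) * ENNReal.ofReal (N / r) = 1 := by
    rw [← ENNReal.ofReal_mul (by positivity), div_mul_div_cancel₀ hN.ne', div_self hr.ne',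
      ENNReal.ofReal_one]
  have hfin : V * (ENNReal.ofReal γ * ∫⁻ x, ‖u x‖ₑ)
      ≤ V * (ENNReal.ofReal (2 ^ N * (2 * L + 1) / N * r) * D) := by
    calc V * (ENNReal.ofReal γ * ∫⁻ x, ‖u x‖ₑ)
        = ENNReal.ofReal (r / N) *
            (ENNReal.ofReal γ * (ENNReal.ofReal (N / r) * V) * ∫⁻ y, ‖u y‖ₑ) := by
          rw [show ENNReal.ofReal (r / N) *
            (ENNReal.ofReal γ * (ENNReal.ofReal (N / r) * V) * ∫⁻ y, ‖u y‖ₑ)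
            = (ENNReal.ofReal (r / N) * ENNReal.ofReal (N / r)) *
              (V * (ENNReal.ofReal γ * ∫⁻ x, ‖u x‖ₑ)) by ring, hscale, one_mul]
      _ ≤ ENNReal.ofReal (r / N) *
            (ENNReal.ofReal (2 ^ N) * V * (ENNReal.ofReal (2 * L + 1) * D)) := by gcongr
      _ = _ := by
          rw [show 2 ^ N * (2 * L + 1) / N * r = r / N * (2 ^ N * (2 * L + 1)) by ring,
            ENNReal.ofReal_mul (by positivity), ENNReal.ofReal_mul (by positivity)]
          ring
  exact (ENNReal.mul_le_mul_iff_right hV0 hVt).1 hfin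

end Poincare

/-! ### Economical covers by small balls -/

section Covering

/-- Compact sets of finite Hausdorff measure have economical finite covers by small balls. -/
theorem exists_ball_cover {X : Type*} [MetricSpace X] [MeasurableSpace X] [BorelSpace X]
    [Nonempty X] {d : ℕ} (hd : d ≠ 0) {s : Set X} (hs : IsCompact s)
    (hfin : μH[(d : ℝ)] s ≠ ⊤) {δ : ℝ} (hδ : 0 < δ) :
    ∃ (F : Finset ℕ) (x : ℕ → X) (r : ℕ → ℝ), (∀ i, 0 < r i ∧ r i ≤ δ) ∧
      s ⊆ ⋃ i ∈ F, Metric.ball (x i) (r i) ∧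
      ∑ i ∈ F, ENNReal.ofReal (r i) ^ d ≤ 2 ^ d * (μH[(d : ℝ)] s + 2 * ENNReal.ofReal δ) := by
  have hδ' : (0 : ℝ≥0∞) < ENNReal.ofReal δ := ENNReal.ofReal_pos.2 hδ
  obtain ⟨t, hst, htd, htsum⟩ : ∃ t : ℕ → Set X, s ⊆ ⋃ n, t n ∧
      (∀ n, Metric.ediam (t n) ≤ ENNReal.ofReal (δ / 2)) ∧
      ∑' n, ⨆ _ : (t n).Nonempty, Metric.ediam (t n) ^ (d : ℝ)
        < μH[(d : ℝ)] s + ENNReal.ofReal δ := by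
    have hlt : (⨅ (t : ℕ → Set X) (_ : s ⊆ ⋃ n, t n)
        (_ : ∀ n, Metric.ediam (t n) ≤ ENNReal.ofReal (δ / 2)),
        ∑' n, ⨆ _ : (t n).Nonempty, Metric.ediam (t n) ^ (d : ℝ))
        < μH[(d : ℝ)] s + ENNReal.ofReal δ := by
      refine lt_of_le_of_lt ?_ (ENNReal.lt_add_right hfin hδ'.ne')
      rw [Measure.hausdorffMeasure_apply]
      exact le_iSup₂_of_le (ENNReal.ofReal (δ / 2)) (ENNReal.ofReal_pos.2 (by positivity)) le_rfl
    simp only [iInf_lt_iff] at hlt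
    obtain ⟨t, h1, h2, h3⟩ := hlt
    exact ⟨t, h1, h2, h3⟩
  obtain ⟨τ', hτ'pos, hτ'sum⟩ := ENNReal.exists_pos_sum_of_countable' hδ'.ne' ℕ
  -- Radii are enlarged by `τ n` so that open balls contain the covering sets. The cap `1` gives `τ
  -- ^ d ≤ τ`, hence summability; the cap `δ / 2` keeps the radii below `δ`.
  let τ : ℕ → ℝ := fun n => min (min (τ' n).toReal 1) (δ / 2)
  have hτ't : ∀ n, τ' n ≠ ⊤ := fun n => (lt_of_le_of_lt (ENNReal.le_tsum n)
    (hτ'sum.trans_le le_top)).ne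
  have hτpos : ∀ n, 0 < τ n := fun n =>
    lt_min (lt_min (ENNReal.toReal_pos (hτ'pos n).ne' (hτ't n)) one_pos) (by positivity)
  have hτle : ∀ n, ENNReal.ofReal (τ n) ^ d ≤ τ' n := fun n => by
    have h1 : ENNReal.ofReal (τ n) ≤ 1 :=
      ENNReal.ofReal_le_one.2 ((min_le_left _ _).trans (min_le_right _ _))
    calc ENNReal.ofReal (τ n) ^ d ≤ ENNReal.ofReal (τ n) ^ 1 :=
          pow_le_pow_right_of_le_one' h1 (Nat.one_le_iff_ne_zero.2 hd)
      _ ≤ ENNReal.ofReal (τ' n).toReal := by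
          rw [pow_one]
          exact ENNReal.ofReal_le_ofReal ((min_le_left _ _).trans (min_le_left _ _))
      _ = τ' n := ENNReal.ofReal_toReal (hτ't n)
  have hdt : ∀ n, Metric.ediam (t n) ≠ ⊤ := fun n =>
    (lt_of_le_of_lt (htd n) ENNReal.ofReal_lt_top).ne
  have hx : ∀ n, ∃ x : X, (t n).Nonempty → x ∈ t n := fun n => by
    by_cases h : (t n).Nonempty
    · exact ⟨h.some, fun h => h.some_mem⟩
    · exact ⟨Classical.arbitrary X, fun h' => absurd h' h⟩
  choose x hx using hx
  let r : ℕ → ℝ := fun n => (Metric.ediam (t n)).toReal + τ n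
  have hr : ∀ n, 0 < r n ∧ r n ≤ δ := fun n => by
    refine ⟨add_pos_of_nonneg_of_pos ENNReal.toReal_nonneg (hτpos n), ?_⟩
    have h1 : (Metric.ediam (t n)).toReal ≤ δ / 2 := ENNReal.toReal_le_of_le_ofReal (by positivity)
      (htd n)
    have h2 : τ n ≤ δ / 2 := min_le_right _ _
    change _ + _ ≤ δ
    linarith
  have hcov : s ⊆ ⋃ n, Metric.ball (x n) (r n) := by
    intro y hy
    obtain ⟨n, hn⟩ := mem_iUnion.1 (hst hy)
    refine mem_iUnion.2 ⟨n, ?_⟩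
    have h1 : edist y (x n) ≤ Metric.ediam (t n) := Metric.edist_le_ediam_of_mem hn (hx n ⟨y, hn⟩)
    rw [Metric.mem_ball, dist_edist]
    exact lt_of_le_of_lt (ENNReal.toReal_mono (hdt n) h1) (lt_add_of_pos_right _ (hτpos n))
  obtain ⟨F, hF⟩ := hs.elim_finite_subcover _ (fun n => Metric.isOpen_ball) hcov
  refine ⟨F, x, r, hr, hF, ?_⟩
  -- The elementary bound `(a + b) ^ d ≤ 2 ^ d * (a ^ d + b ^ d)`.
  have hterm : ∀ n, ENNReal.ofReal (r n) ^ d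
      ≤ 2 ^ d * ((⨆ _ : (t n).Nonempty, Metric.ediam (t n) ^ (d : ℝ)) + τ' n) := fun n => by
    have h1 : ENNReal.ofReal (r n) = Metric.ediam (t n) + ENNReal.ofReal (τ n) := by
      rw [ENNReal.ofReal_add ENNReal.toReal_nonneg (hτpos n).le, ENNReal.ofReal_toReal (hdt n)]
    have h2 : Metric.ediam (t n) ^ d
        ≤ ⨆ _ : (t n).Nonempty, Metric.ediam (t n) ^ (d : ℝ) := by
      rcases (t n).eq_empty_or_nonempty with h | h
      · simp [h, hd]
      · rw [ENNReal.rpow_natCast]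
        exact le_iSup_of_le h le_rfl
    rw [h1]
    calc (Metric.ediam (t n) + ENNReal.ofReal (τ n)) ^ d
        ≤ (2 * max (Metric.ediam (t n)) (ENNReal.ofReal (τ n))) ^ d := by
          gcongr
          rw [two_mul]
          exact add_le_add (le_max_left _ _) (le_max_right _ _)
      _ ≤ 2 ^ d * (Metric.ediam (t n) ^ d + ENNReal.ofReal (τ n) ^ d) := by
          rw [mul_pow]
          gcongr
          rcases max_choice (Metric.ediam (t n)) (ENNReal.ofReal (τ n)) with h | h <;> rw [h]
          · exact le_self_add
          · exact le_add_self
      _ ≤ _ := by gcongr; exact hτle n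
  calc ∑ i ∈ F, ENNReal.ofReal (r i) ^ d
      ≤ ∑ i ∈ F, 2 ^ d * ((⨆ _ : (t i).Nonempty, Metric.ediam (t i) ^ (d : ℝ)) + τ' i) :=
        Finset.sum_le_sum fun i _ => hterm i
    _ ≤ ∑' i, 2 ^ d * ((⨆ _ : (t i).Nonempty, Metric.ediam (t i) ^ (d : ℝ)) + τ' i) :=
        ENNReal.sum_le_tsum F
    _ ≤ 2 ^ d * (μH[(d : ℝ)] s + 2 * ENNReal.ofReal δ) := by
        rw [ENNReal.tsum_mul_left, ENNReal.tsum_add, two_mul, ← add_assoc]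
        gcongr

end Covering

/-! ### Products of cutoffs, and cutting off along a boundary -/

section CutoffProduct

theorem contDiff_prod_one_sub {E ι : Type*} [NormedAddCommGroup E] [NormedSpace ℝ E]
    (F : Finset ι) {η : ι → E → ℝ} (hη : ∀ i, ContDiff ℝ (⊤ : ℕ∞) (η i)) :
    ContDiff ℝ (⊤ : ℕ∞) fun x => ∏ i ∈ F, (1 - η i x) :=
  contDiff_prod fun i _ => contDiff_const.sub (hη i)

/-- In the Leibniz rule every undifferentiated factor lies in `[0, 1]` and can be discarded. -/
theorem norm_fderiv_prod_one_sub_le {E ι : Type*} [NormedAddCommGroup E] [NormedSpace ℝ E]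
    (F : Finset ι) {η : ι → E → ℝ} (hη : ∀ i, ContDiff ℝ (⊤ : ℕ∞) (η i))
    (h01 : ∀ i x, η i x ∈ Icc (0 : ℝ) 1) (x : E) :
    ‖fderiv ℝ (fun x => ∏ i ∈ F, (1 - η i x)) x‖ ≤ ∑ i ∈ F, ‖fderiv ℝ (η i) x‖ := by
  classical
  induction F using Finset.induction_on with
  | empty => simp
  | insert a F ha ih =>
    simp_rw [Finset.prod_insert ha]
    rw [Finset.sum_insert ha]
    have hd : DifferentiableAt ℝ (η a) x := (hη a).differentiable (by simp) x
    rw [fderiv_fun_mul (hd.const_sub 1) ((contDiff_prod_one_sub F hη).differentiable (by simp) x),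
      fderiv_const_sub]
    refine (norm_add_le _ _).trans ?_
    rw [norm_smul, norm_smul, norm_neg, add_comm]
    have h1 : ‖∏ i ∈ F, (1 - η i x)‖ ≤ 1 := by
      rw [norm_prod]
      refine Finset.prod_le_one (fun i _ => norm_nonneg _) fun i _ => ?_
      rw [Real.norm_of_nonneg (sub_nonneg.2 (h01 i x).2)]
      linarith [(h01 i x).1]
    have h2 : ‖1 - η a x‖ ≤ 1 := by
      rw [Real.norm_of_nonneg (sub_nonneg.2 (h01 a x).2)]
      linarith [(h01 a x).1]
    exact add_le_add (mul_le_of_le_one_left (norm_nonneg _) h1)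
      ((mul_le_of_le_one_left (norm_nonneg _) h2).trans ih)

/-- Cutting a smooth function off along the boundary of an open set near which it vanishes. -/
theorem indicator_mem_testFunctions {N : ℕ} {G : Set (EuclideanSpace ℝ (Fin N))} (hG : IsOpen G)
    (hGc : IsCompact (closure G)) {ψ : EuclideanSpace ℝ (Fin N) → ℝ}
    (hψ : ContDiff ℝ (⊤ : ℕ∞) ψ) (hzero : ∀ x ∈ frontier G, ∀ᶠ y in 𝓝 x, ψ y = 0) :
    G.indicator ψ ∈ testFunctions G := by
  -- Smoothness across `∂G`: near each point outside `G` the truncated function vanishes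
  -- identically.
  have hout : ∀ x ∉ G, G.indicator ψ =ᶠ[𝓝 x] fun _ => 0 := by
    intro x hx
    by_cases hxc : x ∈ closure G
    · have hf : x ∈ frontier G := by
        rw [hG.frontier_eq]
        exact ⟨hxc, hx⟩
      filter_upwards [hzero x hf] with y hy
      by_cases hyG : y ∈ G
      · rw [indicator_of_mem hyG, hy]
      · rw [indicator_of_notMem hyG]
    · filter_upwards [isClosed_closure.isOpen_compl.mem_nhds hxc] with y hy
      exact indicator_of_notMem (fun h => hy (subset_closure h)) _
  have hts : tsupport (G.indicator ψ) ⊆ G := fun x hx => by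
    by_contra hxG
    exact (notMem_tsupport_iff_eventuallyEq.2 (hout x hxG)) hx
  refine ⟨contDiff_iff_contDiffAt.2 fun x => ?_, ?_, hts⟩
  · by_cases hx : x ∈ G
    · refine hψ.contDiffAt.congr_of_eventuallyEq ?_
      filter_upwards [hG.mem_nhds hx] with y hy
      exact indicator_of_mem hy _
    · exact contDiffAt_const.congr_of_eventuallyEq (hout x hx)
  · exact hGc.of_isClosed_subset (isClosed_tsupport _) (hts.trans subset_closure)

theorem norm_fderiv_indicator_le {N : ℕ} {G : Set (EuclideanSpace ℝ (Fin N))} (hG : IsOpen G)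
    {ψ : EuclideanSpace ℝ (Fin N) → ℝ} (hts : tsupport (G.indicator ψ) ⊆ G)
    (x : EuclideanSpace ℝ (Fin N)) : ‖fderiv ℝ (G.indicator ψ) x‖ ≤ ‖fderiv ℝ ψ x‖ := by
  by_cases hx : x ∈ G
  · have : G.indicator ψ =ᶠ[𝓝 x] ψ := by
      filter_upwards [hG.mem_nhds hx] with y hy
      exact indicator_of_mem hy _
    rw [this.fderiv_eq]
  · have : fderiv ℝ (G.indicator ψ) x = 0 := by
      by_contra h
      exact hx (hts (support_fderiv_subset ℝ h))
    rw [this, norm_zero]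
    exact norm_nonneg _

end CutoffProduct

/-! ### From a Poincaré inequality to a lower bound for `h` -/

section CheegerLowerBound

/-- One power of `r` is split off: it cancels the `1 / r` of a cutoff gradient, or is bounded by `δ`
when volumes are summed. -/
theorem volume_ball_two_mul {d : ℕ} (x : EuclideanSpace ℝ (Fin (d + 1))) {r : ℝ} (hr : 0 < r) :
    volume (Metric.ball x (2 * r)) = ENNReal.ofReal r *
      (volume (Metric.ball (0 : EuclideanSpace ℝ (Fin (d + 1))) 2) * ENNReal.ofReal r ^ d) := by
  rw [mul_comm 2 r, Measure.addHaar_ball_mul_of_pos _ _ hr, finrank_euclideanSpace_fin,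
    ENNReal.ofReal_pow hr.le, pow_succ]
  ring

/-- If a Poincaré inequality with constant `A` holds on a bounded open set, then its volume is at
most `A` times the measure of its boundary, up to a dimensional factor. -/
theorem exists_volume_le_hausdorffMeasure_frontier {d : ℕ} (hd : d ≠ 0) : ∃ K : ℝ, 0 < K ∧
    ∀ (G : Set (EuclideanSpace ℝ (Fin (d + 1)))) (A : ℝ), IsOpen G → IsCompact (closure G) →
      0 ≤ A → (∀ u ∈ testFunctions G, ∫⁻ x, ‖u x‖ₑ ≤ ENNReal.ofReal A * ∫⁻ x, ‖fderiv ℝ u x‖ₑ) →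
      μH[(d : ℝ)] (frontier G) ≠ ⊤ →
      volume G ≤ ENNReal.ofReal (K * A) * μH[(d : ℝ)] (frontier G) := by
  obtain ⟨L, hL, hcut⟩ := exists_cutoff (EuclideanSpace ℝ (Fin (d + 1))) one_pos one_lt_two
  set c := volume (Metric.ball (0 : EuclideanSpace ℝ (Fin (d + 1))) 2) with hc
  have hc0 : c ≠ 0 := (Metric.measure_ball_pos _ _ two_pos).ne'
  have hct : c ≠ ⊤ := measure_ball_lt_top.ne
  refine ⟨L * c.toReal * 2 ^ d, by have := ENNReal.toReal_pos hc0 hct; positivity,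
    fun G A hG hGc hA hpoin hfin => ?_⟩
  set H := μH[(d : ℝ)] (frontier G) with hH
  -- Test with the indicator of `G` times `∏ (1 - η i)`, the `η i` being cutoffs on balls of radius
  -- at most `δ` covering `∂G`. The total variation is `≲ ∑ r i ^ d`, while the volume lost near
  -- `∂G` is `≲ δ * ∑ r i ^ d` and disappears as `δ → 0`.
  have key : ∀ δ : ℝ, 0 < δ → volume G ≤ (ENNReal.ofReal (A * L) + ENNReal.ofReal δ) *
      (c * (2 ^ d * (H + 2 * ENNReal.ofReal δ))) := by
    intro δ hδ
    have hcompact : IsCompact (frontier G) :=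
      hGc.of_isClosed_subset isClosed_frontier frontier_subset_closure
    obtain ⟨F, x, r, hr, hcov, hsum⟩ := exists_ball_cover hd hcompact hfin hδ
    choose η hη h01 h1 hηc hηs hηL using fun i => hcut (x i) (r i) (hr i).1
    let ψ : EuclideanSpace ℝ (Fin (d + 1)) → ℝ := fun y => ∏ i ∈ F, (1 - η i y)
    have hψ : ContDiff ℝ (⊤ : ℕ∞) ψ := contDiff_prod_one_sub F hη
    have hu : G.indicator ψ ∈ testFunctions G := by
      refine indicator_mem_testFunctions hG hGc hψ fun y hy => ?_
      obtain ⟨i, hi, hyi⟩ := mem_iUnion₂.1 (hcov hy)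
      filter_upwards [Metric.isOpen_ball.mem_nhds hyi] with z hz
      refine Finset.prod_eq_zero hi ?_
      rw [h1 i z (by rw [one_mul]; exact Metric.ball_subset_closedBall hz), sub_self]
    have hgrad : ∫⁻ y, ‖fderiv ℝ (G.indicator ψ) y‖ₑ
        ≤ ENNReal.ofReal L * (c * ∑ i ∈ F, ENNReal.ofReal (r i) ^ d) := by
      calc ∫⁻ y, ‖fderiv ℝ (G.indicator ψ) y‖ₑ ≤ ∫⁻ y, ∑ i ∈ F, ‖fderiv ℝ (η i) y‖ₑ := by
            refine lintegral_mono fun y => ?_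
            simp_rw [← ofReal_norm]
            rw [← ENNReal.ofReal_sum_of_nonneg fun i _ => norm_nonneg _]
            exact ENNReal.ofReal_le_ofReal ((norm_fderiv_indicator_le hG hu.2.2 y).trans
              (norm_fderiv_prod_one_sub_le F hη h01 y))
        _ = ∑ i ∈ F, ∫⁻ y in Metric.ball (x i) (2 * r i), ‖fderiv ℝ (η i) y‖ₑ := by
            rw [lintegral_finsetSum]
            · exact Finset.sum_congr rfl fun i _ => (setLIntegral_enorm_fderiv (hηs i)).symm
            · exact fun i _ => (continuous_enorm.comp
                ((hη i).continuous_fderiv (by simp))).measurable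
        _ ≤ ∑ i ∈ F, ENNReal.ofReal (L / r i) * volume (Metric.ball (x i) (2 * r i)) := by
            refine Finset.sum_le_sum fun i _ => ?_
            rw [← setLIntegral_const]
            refine lintegral_mono fun y => ?_
            rw [← ofReal_norm]
            exact ENNReal.ofReal_le_ofReal (hηL i y)
        _ = ∑ i ∈ F, ENNReal.ofReal L * (c * ENNReal.ofReal (r i) ^ d) := by
            refine Finset.sum_congr rfl fun i _ => ?_
            rw [volume_ball_two_mul _ (hr i).1, ← mul_assoc,
              ← ENNReal.ofReal_mul (by have := (hr i).1; positivity),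
              div_mul_cancel₀ _ (hr i).1.ne']
        _ = _ := by rw [Finset.mul_sum, Finset.mul_sum]
    have hcover : volume (⋃ i ∈ F, Metric.ball (x i) (2 * r i))
        ≤ ENNReal.ofReal δ * (c * ∑ i ∈ F, ENNReal.ofReal (r i) ^ d) := by
      refine (measure_biUnion_finset_le _ _).trans ?_
      rw [Finset.mul_sum, Finset.mul_sum]
      refine Finset.sum_le_sum fun i _ => ?_
      rw [volume_ball_two_mul _ (hr i).1]
      gcongr
      exact (hr i).2
    have hlow : volume (G \ ⋃ i ∈ F, Metric.ball (x i) (2 * r i))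
        ≤ ∫⁻ y, ‖G.indicator ψ y‖ₑ := by
      have hmeas : MeasurableSet (G \ ⋃ i ∈ F, Metric.ball (x i) (2 * r i)) :=
        hG.measurableSet.diff (F.measurableSet_biUnion fun i _ => Metric.isOpen_ball.measurableSet)
      rw [← setLIntegral_one]
      refine (setLIntegral_mono' hmeas fun y hy => ?_).trans (setLIntegral_le_lintegral _ _)
      have : ψ y = 1 := by
        refine Finset.prod_eq_one fun i hi => ?_
        rw [image_eq_zero_of_notMem_tsupport fun h => hy.2 (mem_biUnion hi (hηs i h)), sub_zero]
      rw [indicator_of_mem hy.1, this]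
      simp
    have hvol : volume G ≤ volume (G \ ⋃ i ∈ F, Metric.ball (x i) (2 * r i))
        + volume (⋃ i ∈ F, Metric.ball (x i) (2 * r i)) :=
      (measure_mono (by rw [sdiff_union_self]; exact subset_union_left)).trans
        (measure_union_le _ _)
    calc volume G ≤ ENNReal.ofReal A * (ENNReal.ofReal L * (c * ∑ i ∈ F, ENNReal.ofReal (r i) ^ d))
          + ENNReal.ofReal δ * (c * ∑ i ∈ F, ENNReal.ofReal (r i) ^ d) := by
          refine hvol.trans (add_le_add (hlow.trans ((hpoin _ hu).trans ?_)) hcover)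
          gcongr
      _ = (ENNReal.ofReal (A * L) + ENNReal.ofReal δ) *
          (c * ∑ i ∈ F, ENNReal.ofReal (r i) ^ d) := by
          rw [ENNReal.ofReal_mul hA]
          ring
      _ ≤ _ := by gcongr
  have hlim : Tendsto (fun δ : ℝ => (ENNReal.ofReal (A * L) + ENNReal.ofReal δ) *
      (c * (2 ^ d * (H + 2 * ENNReal.ofReal δ)))) (𝓝[>] 0)
      (𝓝 ((ENNReal.ofReal (A * L) + 0) * (c * (2 ^ d * (H + 2 * 0))))) := by
    have h0 : Tendsto (fun δ : ℝ => ENNReal.ofReal δ) (𝓝[>] 0) (𝓝 0) := by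
      have := (ENNReal.continuous_ofReal.tendsto (0 : ℝ)).mono_left
        (nhdsWithin_le_nhds (s := Ioi (0 : ℝ)))
      simpa using this
    refine ENNReal.Tendsto.mul (tendsto_const_nhds.add h0) (Or.inr (by finiteness)) ?_
      (Or.inr (by finiteness))
    refine ENNReal.Tendsto.const_mul (ENNReal.Tendsto.const_mul (tendsto_const_nhds.add
      (ENNReal.Tendsto.const_mul h0 (Or.inr (by finiteness)))) (Or.inr (by finiteness)))
      (Or.inr hct)
  refine (ge_of_tendsto hlim (mem_of_superset self_mem_nhdsWithin key)).trans_eq ?_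
  have h2 : ENNReal.ofReal (2 ^ d) = 2 ^ d := by
    rw [ENNReal.ofReal_pow zero_le_two]; simp
  rw [show L * c.toReal * 2 ^ d * A = A * L * c.toReal * 2 ^ d by ring,
    ENNReal.ofReal_mul (q := 2 ^ d) (by positivity),
    ENNReal.ofReal_mul (q := c.toReal) (by positivity), ENNReal.ofReal_toReal hct, h2]
  ring

/-- A Poincaré inequality on `Ω` bounds the Cheeger constant of `Ω` from below. -/
theorem exists_cheegerConstant_lower_bound {N : ℕ} (hN : 2 ≤ N) : ∃ K : ℝ, 0 < K ∧
    ∀ (Ω : Set (EuclideanSpace ℝ (Fin N))) (A : ℝ), 0 < A →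
      (∀ u ∈ testFunctions Ω, ∫⁻ x, ‖u x‖ₑ ≤ ENNReal.ofReal A * ∫⁻ x, ‖fderiv ℝ u x‖ₑ) →
      ENNReal.ofReal (K / A) ≤ cheegerConstant Ω := by
  obtain ⟨d, rfl⟩ : ∃ d, N = d + 1 := ⟨N - 1, by omega⟩
  have hd : d ≠ 0 := by omega
  obtain ⟨K, hK, h⟩ := exists_volume_le_hausdorffMeasure_frontier hd
  -- `κ` converts `μH[d]` into the normalized `μHE[d]`; it is nonzero and depends only on `d`.
  set κ := Measure.addHaarScalarFactor (volume : Measure (EuclideanSpace ℝ (Fin d))) μH[d] with hκ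
  have hκ0 : κ ≠ 0 := Measure.addHaarScalarFactor_volume_hausdorffMeasure_ne_zero d
  have hκpos : (0 : ℝ) < κ := by exact_mod_cast pos_iff_ne_zero.2 hκ0
  refine ⟨κ / K, by positivity, fun Ω A hA hpoin => le_iInf₂ fun G hG => ?_⟩
  obtain ⟨hGo, hGn, hGc, hGΩ, -⟩ := hG
  have hHE : (μHE[d + 1 - 1] : Measure (EuclideanSpace ℝ (Fin (d + 1)))) (frontier G)
      = κ * μH[(d : ℝ)] (frontier G) := rfl
  have hvt : volume G ≠ ⊤ := ((measure_mono subset_closure).trans_lt hGc.measure_lt_top).ne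
  have hv0 : volume G ≠ 0 := (hGo.measure_pos volume hGn).ne'
  rw [hHE, ENNReal.le_div_iff_mul_le (Or.inl hv0) (Or.inl hvt)]
  by_cases hfin : μH[(d : ℝ)] (frontier G) = ⊤
  · rw [hfin, ENNReal.mul_top (by exact_mod_cast hκ0)]
    exact le_top
  have hsub : G ⊆ Ω := subset_closure.trans hGΩ
  have := h G A hGo hGc hA.le (fun u hu => hpoin u ⟨hu.1, hu.2.1, hu.2.2.trans hsub⟩) hfin
  calc ENNReal.ofReal (κ / K / A) * volume G
      ≤ ENNReal.ofReal (κ / K / A) * (ENNReal.ofReal (K * A) * μH[(d : ℝ)] (frontier G)) := by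
        gcongr
    _ = _ := by
        rw [← mul_assoc, ← ENNReal.ofReal_mul (by positivity),
          show (κ : ℝ) / K / A * (K * A) = κ by field_simp, ENNReal.ofReal_coe_nnreal]

/-- The Cheeger constant is bounded from below by the inverse of the capacitary inradius. -/
theorem exists_div_capInradius_le_cheegerConstant {N : ℕ} (hN : 2 ≤ N) : ∃ σ : ℝ, 0 < σ ∧
    ∀ γ ∈ Ioo (0 : ℝ) 1, ∀ Ω : Set (EuclideanSpace ℝ (Fin N)), IsOpen Ω →
      ENNReal.ofReal (σ * γ) / capInradius 1 γ Ω ≤ cheegerConstant Ω := by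
  have : NeZero N := ⟨by omega⟩
  obtain ⟨K₁, hK₁, h₁⟩ := exists_poincare_const N
  obtain ⟨K₂, hK₂, h₂⟩ := exists_cheegerConstant_lower_bound hN
  refine ⟨K₂ / K₁, by positivity, fun γ hγ Ω hΩ => ?_⟩
  -- A radius above the inradius is negligible at no centre, so the Poincaré inequality holds with
  -- constant `K₁ * r / γ`.
  have key : ∀ r : ℝ, 0 < r → capInradius 1 γ Ω < ENNReal.ofReal r →
      ENNReal.ofReal (K₂ / K₁ * γ) / ENNReal.ofReal r ≤ cheegerConstant Ω := by
    intro r hr hlt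
    have hcap : ∀ x₀, ENNReal.ofReal γ * relCap 1 (Metric.closedBall x₀ r) (Metric.ball x₀ (2 * r))
        ≤ relCap 1 (Metric.closedBall x₀ r \ Ω) (Metric.ball x₀ (2 * r)) := by
      intro x₀
      by_contra hcon
      refine hlt.not_ge (le_iSup₂_of_le (f := fun (r : ℝ) _ => ENNReal.ofReal r) r ?_ le_rfl)
      exact ⟨hr, x₀, (isCompact_closedBall _ _).diff hΩ, sdiff_subset, (not_le.1 hcon).le⟩
    have hA : 0 < K₁ * r / γ := by have := hγ.1; positivity
    have := h₂ Ω (K₁ * r / γ) hA fun u hu => by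
      have h := h₁ γ r Ω hγ.1 hr hcap u hu
      have hγ0 : ENNReal.ofReal γ ≠ 0 := (ENNReal.ofReal_pos.2 hγ.1).ne'
      refine (ENNReal.mul_le_mul_iff_right hγ0 ENNReal.ofReal_ne_top).1 (h.trans_eq ?_)
      rw [← mul_assoc, ← ENNReal.ofReal_mul hγ.1.le, mul_div_cancel₀ _ hγ.1.ne']
    refine le_trans (le_of_eq ?_) this
    rw [← ENNReal.ofReal_div_of_pos hr]
    congr 1
    have := hγ.1.ne'
    field_simp
  rcases eq_or_ne (capInradius 1 γ Ω) ⊤ with htop | htop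
  · simp [htop]
  have hσ : ENNReal.ofReal (K₂ / K₁ * γ) ≠ 0 :=
    (ENNReal.ofReal_pos.2 (by have := hγ.1; positivity)).ne'
  set R := (capInradius 1 γ Ω).toReal with hR
  have hRe : capInradius 1 γ Ω = ENNReal.ofReal R := (ENNReal.ofReal_toReal htop).symm
  -- Let `r` decrease to the inradius. The case `R = 0` is included: the limit is then `⊤`.
  have hlim : Tendsto (fun r : ℝ => ENNReal.ofReal (K₂ / K₁ * γ) / ENNReal.ofReal r) (𝓝[>] R)
      (𝓝 (ENNReal.ofReal (K₂ / K₁ * γ) / ENNReal.ofReal R)) := by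
    refine ENNReal.Tendsto.const_div ?_ (Or.inr ENNReal.ofReal_ne_top)
    exact (ENNReal.continuous_ofReal.tendsto R).mono_left nhdsWithin_le_nhds
  rw [hRe]
  refine le_of_tendsto hlim (mem_of_superset self_mem_nhdsWithin fun r hr => ?_)
  have hr0 : 0 < r := lt_of_le_of_lt ENNReal.toReal_nonneg hr
  refine key r hr0 ?_
  rw [hRe]
  exact (ENNReal.ofReal_lt_ofReal_iff hr0).2 hr

end CheegerLowerBound

/-! ### A coarea inequality with a dimensional constant -/

section Coarea

/-- A compact set is covered by finitely many balls whose halves are disjoint. -/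
theorem exists_finset_separated_cover {X : Type*} [MetricSpace X] {K : Set X}
    (hK : IsCompact K) {δ : ℝ} (hδ : 0 < δ) :
    ∃ S : Finset X, (↑S : Set X) ⊆ K ∧ K ⊆ ⋃ x ∈ S, Metric.closedBall x δ ∧
      (↑S : Set X).PairwiseDisjoint fun x => Metric.ball x (δ / 2) := by
  lift δ to NNReal using hδ.le
  have hδ' : δ / 2 ≠ 0 := by
    have : (0 : NNReal) < δ := by exact_mod_cast hδ
    positivity
  -- The centres form a maximal `δ`-separated set; it is finite because a finite cover by `δ /
  -- 2`-balls bounds the packing number.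
  have hpack : Metric.packingNumber δ K ≠ ⊤ := by
    obtain ⟨T, -, hTf, hTc⟩ := Metric.exists_finite_isCover_of_isCompact hδ' hK
    have h1 := Metric.packingNumber_two_mul_le_externalCoveringNumber (δ / 2) K
    rw [mul_div_cancel₀ _ (two_ne_zero)] at h1
    exact ((h1.trans hTc.externalCoveringNumber_le_encard).trans_lt hTf.encard_lt_top).ne
  have hcard := Metric.encard_maximalSeparatedSet hpack
  have hfin : (Metric.maximalSeparatedSet δ K).Finite := by
    rw [← encard_ne_top_iff, hcard]
    exact hpack
  refine ⟨hfin.toFinset, ?_, ?_, ?_⟩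
  · simpa using Metric.maximalSeparatedSet_subset
  · have := Metric.isCover_iff_subset_iUnion_closedBall.1 (Metric.isCover_maximalSeparatedSet hpack)
    simpa using this
  · intro x hx y hy hxy
    have hsep : (δ : ℝ≥0∞) < edist x y := Metric.isSeparated_maximalSeparatedSet
      (ε := δ) (A := K) (by simpa using hx) (by simpa using hy) hxy
    refine Metric.ball_disjoint_ball ?_
    rw [add_halves, dist_edist]
    exact (ENNReal.toReal_mono (edist_ne_top _ _) hsep.le)

variable {d : ℕ}

/-- A discretized coarea inequality at scale `ε`. -/
theorem exists_discrete_coarea (hd : d ≠ 0) {v : EuclideanSpace ℝ (Fin (d + 1)) → ℝ}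
    (hv : Differentiable ℝ v) (huc : UniformContinuous (fderiv ℝ v))
    (x₀ : EuclideanSpace ℝ (Fin (d + 1))) {r : ℝ} (hr : 0 < r) {ε : ℝ} (hε : 0 < ε) :
    ∃ (S : Finset (EuclideanSpace ℝ (Fin (d + 1)))) (δ : ℝ) (g : ℝ → ℝ≥0∞), 0 < δ ∧ δ ≤ ε ∧
      Measurable g ∧ Metric.closedBall x₀ r ⊆ ⋃ x ∈ S, Metric.closedBall x δ ∧
      (∀ t, ∑ x ∈ S, Metric.ediam (Metric.closedBall x δ ∩ v ⁻¹' {t}) ^ (d : ℝ) ≤ g t) ∧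
      ∫⁻ t, g t ≤ ENNReal.ofReal (4 ^ (d + 1)) /
        volume (Metric.ball (0 : EuclideanSpace ℝ (Fin (d + 1))) 1) *
        ∫⁻ x in Metric.ball x₀ (2 * r), (‖fderiv ℝ v x‖ₑ + ENNReal.ofReal (2 * ε)) := by
  obtain ⟨δ₀, hδ₀, hδ₀'⟩ := Metric.uniformContinuous_iff.1 huc ε hε
  obtain ⟨δ, hδ, hδle⟩ : ∃ δ : ℝ, 0 < δ ∧ δ < δ₀ ∧ δ ≤ r ∧ δ ≤ ε :=
    ⟨min (δ₀ / 2) (min r ε), by positivity, (min_le_left _ _).trans_lt (by linarith),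
      (min_le_right _ _).trans (min_le_left _ _), (min_le_right _ _).trans (min_le_right _ _)⟩
  have hosc : ∀ x y, dist y x ≤ δ → ‖fderiv ℝ v y - fderiv ℝ v x‖ ≤ ε := fun x y h => by
    rw [← dist_eq_norm]
    exact (hδ₀' (h.trans_lt hδle.1)).le
  obtain ⟨S, hSK, hcov, hdisj⟩ := exists_finset_separated_cover (isCompact_closedBall x₀ r) hδ
  let ℓ : EuclideanSpace ℝ (Fin (d + 1)) → ℝ := fun x => ‖fderiv ℝ v x‖ + ε
  have hℓ : ∀ x, 0 ≤ ℓ x := fun x => by positivity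
  -- Mean value inequality: a level `t` meets the ball around `x` only if `t` lies in an interval of
  -- length `2 * ℓ x * δ`.
  have hval : ∀ x, ∀ y ∈ Metric.closedBall x δ, v y ∈ Icc (v x - ℓ x * δ) (v x + ℓ x * δ) := by
    intro x y hy
    have hbound : ‖v y - v x‖ ≤ ℓ x * ‖y - x‖ := by
      refine (convex_closedBall x δ).norm_image_sub_le_of_norm_fderiv_le
        (fun z _ => hv z) (fun z hz => ?_) (Metric.mem_closedBall_self hδ.le) hy
      have := hosc x z hz
      calc ‖fderiv ℝ v z‖ = ‖fderiv ℝ v x + (fderiv ℝ v z - fderiv ℝ v x)‖ := by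
            rw [add_sub_cancel]
        _ ≤ ℓ x := (norm_add_le _ _).trans (add_le_add le_rfl this)
    rw [Metric.mem_closedBall, dist_eq_norm] at hy
    have h2 : ‖v y - v x‖ ≤ ℓ x * δ := hbound.trans (mul_le_mul_of_nonneg_left hy (hℓ x))
    rw [Real.norm_eq_abs, abs_le] at h2
    exact ⟨by linarith [h2.1], by linarith [h2.2]⟩
  -- Each ball whose interval contains `t` is charged `(2 * δ) ^ d`. This majorizes the sum of the
  -- diameters to the power `d` and is visibly measurable in `t`.
  let g : ℝ → ℝ≥0∞ := fun t => ∑ x ∈ S, (Icc (v x - ℓ x * δ) (v x + ℓ x * δ)).indicator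
    (fun _ => ENNReal.ofReal (2 * δ) ^ d) t
  refine ⟨S, δ, g, hδ, hδle.2.2, ?_, hcov, fun t => Finset.sum_le_sum fun x _ => ?_, ?_⟩
  · exact Finset.measurable_sum _ fun x _ => measurable_const.indicator measurableSet_Icc
  · rw [ENNReal.rpow_natCast]
    rcases (Metric.closedBall x δ ∩ v ⁻¹' {t}).eq_empty_or_nonempty with h | ⟨y, hy, hyt⟩
    · simp [h, hd]
    · rw [indicator_of_mem (by rw [← (show v y = t from hyt)]; exact hval x y hy)]
      gcongr
      refine (Metric.ediam_mono inter_subset_left).trans ?_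
      refine Metric.ediam_le fun z hz w hw => ?_
      rw [edist_dist]
      refine ENNReal.ofReal_le_ofReal ?_
      linarith [dist_triangle_right z w x, Metric.mem_closedBall.1 hz, Metric.mem_closedBall.1 hw]
  · set ω := volume (Metric.ball (0 : EuclideanSpace ℝ (Fin (d + 1))) 1) with hω
    have hω0 : ω ≠ 0 := (Metric.measure_ball_pos _ _ one_pos).ne'
    have hωt : ω ≠ ⊤ := measure_ball_lt_top.ne
    have hterm : ∀ x ∈ S, ∫⁻ t, (Icc (v x - ℓ x * δ) (v x + ℓ x * δ)).indicator
          (fun _ => ENNReal.ofReal (2 * δ) ^ d) t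
        ≤ ENNReal.ofReal (4 ^ (d + 1)) / ω *
          ∫⁻ y in Metric.ball x (δ / 2), (‖fderiv ℝ v y‖ₑ + ENNReal.ofReal (2 * ε)) := by
      intro x _
      -- Interval length times charge is `(2 * δ) ^ (d + 1) * ℓ x`, that is `4 ^ (d + 1) / ω` times
      -- the volume of the half ball times `ℓ x`. The half balls are disjoint, so the sum becomes
      -- one integral.
      have hvol : ENNReal.ofReal (4 ^ (d + 1)) / ω * volume (Metric.ball x (δ / 2))
          = ENNReal.ofReal ((2 * δ) ^ (d + 1)) := by
        rw [Measure.addHaar_ball _ _ (by positivity), finrank_euclideanSpace_fin, ← hω,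
          ENNReal.div_eq_inv_mul, mul_assoc, ← mul_assoc (ENNReal.ofReal (4 ^ (d + 1))),
          ← ENNReal.ofReal_mul (by positivity), mul_comm, mul_assoc,
          ENNReal.mul_inv_cancel hω0 hωt, mul_one, ← mul_pow]
        congr 2
        ring
      calc ∫⁻ t, (Icc (v x - ℓ x * δ) (v x + ℓ x * δ)).indicator
            (fun _ => ENNReal.ofReal (2 * δ) ^ d) t
          = ENNReal.ofReal ((2 * δ) ^ (d + 1)) * ENNReal.ofReal (ℓ x) := by
            rw [lintegral_indicator measurableSet_Icc, setLIntegral_const, Real.volume_Icc,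
              ← ENNReal.ofReal_pow (by positivity), ← ENNReal.ofReal_mul (by positivity),
              ← ENNReal.ofReal_mul (by positivity)]
            congr 1
            ring
        _ = ENNReal.ofReal (4 ^ (d + 1)) / ω *
            ∫⁻ y in Metric.ball x (δ / 2), ENNReal.ofReal (ℓ x) := by
            rw [setLIntegral_const, ← hvol]
            ring
        _ ≤ _ := by
            gcongr ENNReal.ofReal (4 ^ (d + 1)) / ω * ?_
            refine setLIntegral_mono' Metric.isOpen_ball.measurableSet fun y hy => ?_
            rw [← ofReal_norm, ← ENNReal.ofReal_add (norm_nonneg _) (by positivity)]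
            refine ENNReal.ofReal_le_ofReal ?_
            have h1 := hosc x y (by rw [Metric.mem_ball] at hy; linarith)
            have h2 := norm_sub_norm_le (fderiv ℝ v x) (fderiv ℝ v y)
            rw [norm_sub_rev] at h2
            change ‖fderiv ℝ v x‖ + ε ≤ _
            linarith
    rw [lintegral_finsetSum _ fun x _ => measurable_const.indicator measurableSet_Icc]
    refine (Finset.sum_le_sum hterm).trans ?_
    rw [← Finset.mul_sum]
    gcongr
    rw [← lintegral_biUnion_finset hdisj fun x _ => Metric.isOpen_ball.measurableSet]
    refine lintegral_mono_set (iUnion₂_subset fun x hx => ?_)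
    have hx' := Metric.mem_closedBall.1 (hSK hx)
    exact Metric.ball_subset_ball' (by linarith [hδle.2.1])

/-- The coarea inequality, with a non-optimal constant. -/
theorem lintegral_hausdorffMeasure_level_le (hd : d ≠ 0)
    {v : EuclideanSpace ℝ (Fin (d + 1)) → ℝ} (hv : Differentiable ℝ v)
    (huc : UniformContinuous (fderiv ℝ v)) (x₀ : EuclideanSpace ℝ (Fin (d + 1))) {r : ℝ}
    (hr : 0 < r) :
    ∫⁻ t, μH[(d : ℝ)] (Metric.closedBall x₀ r ∩ v ⁻¹' {t}) ≤ ENNReal.ofReal (4 ^ (d + 1)) /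
        volume (Metric.ball (0 : EuclideanSpace ℝ (Fin (d + 1))) 1) *
        ∫⁻ x in Metric.ball x₀ (2 * r), ‖fderiv ℝ v x‖ₑ := by
  set ω := volume (Metric.ball (0 : EuclideanSpace ℝ (Fin (d + 1))) 1) with hω
  have hω0 : ω ≠ 0 := (Metric.measure_ball_pos _ _ one_pos).ne'
  have hcoef : ENNReal.ofReal (4 ^ (d + 1)) / ω ≠ ⊤ := by finiteness
  have hεpos : ∀ n : ℕ, (0 : ℝ) < 1 / ((n : ℝ) + 1) := fun n => Nat.one_div_pos_of_nat
  choose S δ g hδ hδε hg hcov hsum hintegral using fun n : ℕ =>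
    exists_discrete_coarea hd hv huc x₀ hr (hεpos n)
  have hscale : Tendsto (fun n : ℕ => ENNReal.ofReal (2 * (1 / ((n : ℝ) + 1)))) atTop (𝓝 0) := by
    have h := (ENNReal.continuous_ofReal.tendsto _).comp
      ((tendsto_one_div_add_atTop_nhds_zero_nat (𝕜 := ℝ)).const_mul 2)
    rwa [mul_zero, ENNReal.ofReal_zero] at h
  have hlevel : ∀ t, μH[(d : ℝ)] (Metric.closedBall x₀ r ∩ v ⁻¹' {t})
      ≤ liminf (fun n => g n t) atTop := by
    intro t
    have h := Measure.hausdorffMeasure_le_liminf_sum (ι := fun n => S n) (l := atTop) (d : ℝ)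
      (Metric.closedBall x₀ r ∩ v ⁻¹' {t}) (fun n : ℕ => ENNReal.ofReal (2 * (1 / ((n : ℝ) + 1))))
      ?_ (fun n x => Metric.closedBall x.1 (δ n) ∩ v ⁻¹' {t}) ?_ ?_
    · refine h.trans (liminf_le_liminf (Eventually.of_forall fun n => ?_))
      refine le_trans (le_of_eq ?_) (hsum n t)
      exact Finset.sum_coe_sort (S n)
        fun x => Metric.ediam (Metric.closedBall x (δ n) ∩ v ⁻¹' {t}) ^ (d : ℝ)
    · exact hscale
    · refine Eventually.of_forall fun n x => (Metric.ediam_mono inter_subset_left).trans ?_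
      refine Metric.ediam_le fun z hz w hw => ?_
      rw [edist_dist]
      refine ENNReal.ofReal_le_ofReal ?_
      linarith [dist_triangle_right z w x.1, Metric.mem_closedBall.1 hz,
        Metric.mem_closedBall.1 hw, hδε n]
    · refine Eventually.of_forall fun n y hy => ?_
      obtain ⟨x, hx, hyx⟩ := mem_iUnion₂.1 (hcov n hy.1)
      exact mem_iUnion.2 ⟨⟨x, hx⟩, hyx, hy.2⟩
  -- Fatou for the measurable majorants `g n`; measurability of the level measure in `t` is not
  -- needed.
  refine (lintegral_mono hlevel).trans ((lintegral_liminf_le hg).trans ?_)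
  have hmeas : Measurable fun x => ‖fderiv ℝ v x‖ₑ :=
    (continuous_enorm.comp huc.continuous).measurable
  have hlim : Tendsto (fun n : ℕ => ENNReal.ofReal (4 ^ (d + 1)) / ω *
      ∫⁻ x in Metric.ball x₀ (2 * r),
        (‖fderiv ℝ v x‖ₑ + ENNReal.ofReal (2 * (1 / ((n : ℝ) + 1))))) atTop
      (𝓝 (ENNReal.ofReal (4 ^ (d + 1)) / ω *
        (∫⁻ x in Metric.ball x₀ (2 * r), ‖fderiv ℝ v x‖ₑ + 0))) := by
    refine ENNReal.Tendsto.const_mul ?_ (Or.inr hcoef)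
    simp_rw [lintegral_add_left hmeas, setLIntegral_const]
    refine tendsto_const_nhds.add (ENNReal.Tendsto.mul_const hscale ?_)
    exact Or.inr measure_ball_lt_top.ne
  simp only [add_zero] at hlim
  rw [← hlim.liminf_eq]
  exact liminf_le_liminf (Eventually.of_forall hintegral)

end Coarea

/-! ### Generic linear perturbations -/

section Sard

/-- A generic small linear perturbation of a smooth function has finitely many critical points in
any compact set. -/
theorem exists_perturbation_finite_critical {E : Type*} [NormedAddCommGroup E]
    [InnerProductSpace ℝ E] [FiniteDimensional ℝ E] [MeasurableSpace E] [BorelSpace E]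
    {u : E → ℝ} (hu : ContDiff ℝ 2 u) {K : Set E} (hK : IsCompact K) {ε : ℝ} (hε : 0 < ε) :
    ∃ a : E, ‖a‖ < ε ∧ {x ∈ K | fderiv ℝ u x + innerSL ℝ a = 0}.Finite := by
  let D := (InnerProductSpace.toDual ℝ E).symm
  let G : E → E := fun x => D (fderiv ℝ u x)
  have hG : ContDiff ℝ 1 G := by
    have h1 : ContDiff ℝ 1 (fderiv ℝ u) := hu.fderiv_right (by norm_num)
    have hD : IsBoundedLinearMap ℝ D :=
      ⟨⟨map_add D, fun c x => by simp⟩, 1, one_pos, fun x => by simp⟩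
    exact hD.contDiff.comp h1
  have hGd : Differentiable ℝ G := hG.differentiable one_ne_zero
  -- Sard in equal dimensions: the image under the gradient map `G` of the points where `DG` is
  -- singular is null, so arbitrarily small regular values `b` exist. The critical points of `u -
  -- ⟪b, ·⟫` are the solutions of `G x = b`.
  let B : Set E := {x | (fderiv ℝ G x).det = 0}
  have hnull : volume (G '' B) = 0 :=
    addHaar_image_eq_zero_of_det_fderivWithin_eq_zero volume
      (fun x _ => (hGd x).hasFDerivAt.hasFDerivWithinAt) fun x hx => hx
  obtain ⟨b, hbε, hbG⟩ : ∃ b ∈ Metric.ball (0 : E) ε, b ∉ G '' B := by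
    by_contra! hcon
    have := (measure_mono hcon).trans_eq hnull
    exact (Metric.measure_ball_pos volume (0 : E) hε).not_ge this
  have hcrit : ∀ x, fderiv ℝ u x + innerSL ℝ (-b) = 0 ↔ G x = b := by
    intro x
    rw [map_neg, ← sub_eq_add_neg, sub_eq_zero]
    constructor
    · intro h
      change D (fderiv ℝ u x) = b
      rw [h]
      exact (InnerProductSpace.toDual ℝ E).symm_apply_apply b
    · intro h
      rw [← h]
      exact ((InnerProductSpace.toDual ℝ E).apply_symm_apply _).symm
  refine ⟨-b, by simpa using hbε, ?_⟩
  simp_rw [hcrit]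
  have hclosed : IsClosed {x | G x = b} := isClosed_eq hG.continuous continuous_const
  have hcomp : IsCompact {x ∈ K | G x = b} := hK.inter_right hclosed
  -- At a regular value the derivative of `G` is injective, so solutions are isolated; a discrete
  -- compact set is finite.
  refine hcomp.finite (isDiscrete_iff_nhdsNE.2 fun x hx => ?_)
  have hdet : (fderiv ℝ G x).det ≠ 0 := fun h => hbG ⟨x, h, hx.2⟩
  have hanti : ∃ C, AntilipschitzWith C (fderiv ℝ G x) :=
    ⟨_, ((fderiv ℝ G x).toContinuousLinearEquivOfDetNeZero hdet).antilipschitz⟩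
  have hne := (hGd x).hasFDerivAt.eventually_ne (c := b) hanti
  rw [← disjoint_iff, disjoint_principal_right]
  filter_upwards [hne] with y hy hyK
  exact hy hyK.2

end Sard

/-! ### From a negligible complement to an upper bound for `h` -/

section CheegerUpperBound

theorem exists_lt_of_lintegral_lt {g : ℝ → ℝ≥0∞} {a b : ℝ} {M : ℝ≥0∞} {Z : Set ℝ} (hZ : Z.Finite)
    (h : ∫⁻ t, g t < M * ENNReal.ofReal (b - a)) : ∃ t ∈ Ioo a b, t ∉ Z ∧ g t < M := by
  by_contra! hcon
  refine h.not_ge ?_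
  have hvol : volume (Ioo a b \ Z) = ENNReal.ofReal (b - a) := by
    rw [measure_sdiff_null (hZ.measure_zero _), Real.volume_Ioo]
  rw [← hvol, ← setLIntegral_const]
  refine (setLIntegral_mono' (measurableSet_Ioo.diff hZ.measurableSet) fun t ht => ?_).trans
    (setLIntegral_le_lintegral _ _)
  exact hcon t ht.1 ht.2

/-- A superlevel set of a smooth function, after a small perturbation, is a competitor for the
Cheeger constant whose boundary is controlled by the total variation of the function. -/
theorem exists_smooth_superlevel {d : ℕ} (hd : d ≠ 0) : ∃ K : ℝ, 0 < K ∧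
    ∀ (u : EuclideanSpace ℝ (Fin (d + 1)) → ℝ) (x₀ : EuclideanSpace ℝ (Fin (d + 1))) (r s D : ℝ),
      0 < r → 0 < s → 0 < D → u ∈ testFunctions (Metric.ball x₀ r) →
      ∫⁻ x, ‖fderiv ℝ u x‖ₑ ≤ ENNReal.ofReal D → {x | s < u x}.Nonempty →
      ∃ G ∈ cheegerSets {x | 0 < u x}, {x | s < u x} ⊆ G ∧
        μH[(d : ℝ)] (frontier G) ≤ ENNReal.ofReal (K * D / s) := by
  set ω := volume (Metric.ball (0 : EuclideanSpace ℝ (Fin (d + 1))) 1) with hω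
  have hω0 : ω ≠ 0 := (Metric.measure_ball_pos _ _ one_pos).ne'
  have hωt : ω ≠ ⊤ := measure_ball_lt_top.ne
  have hωpos : 0 < ω.toReal := ENNReal.toReal_pos hω0 hωt
  -- `16 = 4 * 2 * 2`: the levels range over an interval of length `s / 4`, the perturbed total
  -- variation is at most `2 * D`, and a factor `2` makes the averaging inequality strict.
  refine ⟨16 * 4 ^ (d + 1) / ω.toReal, by positivity,
    fun u x₀ r s D hr hs hD hu hintegral hne => ?_⟩
  set W := (volume (Metric.ball x₀ (2 * r))).toReal with hW
  have hWe : volume (Metric.ball x₀ (2 * r)) = ENNReal.ofReal W :=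
    (ENNReal.ofReal_toReal measure_ball_lt_top.ne).symm
  have hW0 : 0 ≤ W := ENNReal.toReal_nonneg
  -- The two bounds on `b` make the perturbation at most `s / 8` on the ball and its total variation
  -- on `B_{2r}` at most `D`.
  obtain ⟨b, hb, hfin⟩ := exists_perturbation_finite_critical
    (contDiff_infty.1 hu.1 2) (isCompact_closedBall x₀ r)
    (ε := min (s / (8 * r)) (D / (W + 1))) (by positivity)
  have hb1 : ‖b‖ * r ≤ s / 8 := by
    have := (hb.trans_le (min_le_left _ _)).le
    rw [le_div_iff₀ (by positivity)] at this
    linarith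
  have hb2 : ‖b‖ * W ≤ D := by
    have := (hb.trans_le (min_le_right _ _)).le
    rw [le_div_iff₀ (by positivity)] at this
    nlinarith [norm_nonneg b]
  let v : EuclideanSpace ℝ (Fin (d + 1)) → ℝ := fun x => u x + inner ℝ b (x - x₀)
  have hv : ContDiff ℝ (⊤ : ℕ∞) v :=
    hu.1.add (contDiff_const.inner ℝ (contDiff_id.sub contDiff_const))
  have hdv : ∀ x, HasFDerivAt v (fderiv ℝ u x + innerSL ℝ b) x := fun x =>
    (hu.1.differentiable (by simp) x).hasFDerivAt.add
      ((innerSL ℝ b).hasFDerivAt.comp x ((hasFDerivAt_id x).sub_const x₀))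
  have hfdv : fderiv ℝ v = fun x => fderiv ℝ u x + innerSL ℝ b := funext fun x => (hdv x).fderiv
  have huv : ∀ x ∈ Metric.closedBall x₀ r, |v x - u x| ≤ s / 8 := fun x hx => by
    simp only [v, add_sub_cancel_left]
    refine (abs_real_inner_le_norm _ _).trans (le_trans ?_ hb1)
    rw [Metric.mem_closedBall, dist_eq_norm] at hx
    gcongr
  have huc : UniformContinuous (fderiv ℝ v) := by
    rw [hfdv]
    have hcf : Continuous (fderiv ℝ u) := hu.1.continuous_fderiv (by simp)
    exact ((hu.2.1.fderiv ℝ).uniformContinuous_of_continuous hcf).add uniformContinuous_const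
  have hco := lintegral_hausdorffMeasure_level_le hd (hv.differentiable (by simp)) huc x₀ hr
  have hgrad : ∫⁻ x in Metric.ball x₀ (2 * r), ‖fderiv ℝ v x‖ₑ ≤ ENNReal.ofReal (2 * D) := by
    calc ∫⁻ x in Metric.ball x₀ (2 * r), ‖fderiv ℝ v x‖ₑ
        ≤ ∫⁻ x in Metric.ball x₀ (2 * r), (‖fderiv ℝ u x‖ₑ + ENNReal.ofReal ‖b‖) := by
          refine lintegral_mono fun x => ?_
          rw [hfdv, ← ofReal_norm, ← ofReal_norm, ← ENNReal.ofReal_add (norm_nonneg _)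
            (norm_nonneg _)]
          refine ENNReal.ofReal_le_ofReal ((norm_add_le _ _).trans_eq ?_)
          rw [innerSL_apply_norm]
      _ ≤ ENNReal.ofReal D + ENNReal.ofReal D := by
          rw [lintegral_add_right _ measurable_const, setLIntegral_const, hWe,
            ← ENNReal.ofReal_mul (norm_nonneg _)]
          exact add_le_add ((setLIntegral_le_lintegral _ _).trans hintegral)
            (ENNReal.ofReal_le_ofReal hb2)
      _ = ENNReal.ofReal (2 * D) := by rw [← ENNReal.ofReal_add hD.le hD.le, two_mul]
  have hcoef : ENNReal.ofReal (4 ^ (d + 1)) / ω = ENNReal.ofReal (4 ^ (d + 1) / ω.toReal) := by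
    rw [ENNReal.ofReal_div_of_pos hωpos, ENNReal.ofReal_toReal hωt]
  -- A level in `(s / 4, s / 2)` that is not a critical value. As `|v - u| ≤ s / 8`, it separates
  -- `{s < u}` from the zero set of `u`.
  obtain ⟨t, ht, htZ, htM⟩ := exists_lt_of_lintegral_lt (a := s / 4) (b := s / 2)
    (M := ENNReal.ofReal (16 * 4 ^ (d + 1) / ω.toReal * D / s)) (hfin.image v) <| by
      refine (hco.trans (mul_le_mul_right hgrad _)).trans_lt ?_
      have h1 : (16 * 4 ^ (d + 1) / ω.toReal * D / s) * (s / 2 - s / 4)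
          = 2 * (4 ^ (d + 1) / ω.toReal * (2 * D)) := by field_simp; ring
      have h2 : 0 < 4 ^ (d + 1) / ω.toReal * (2 * D) := by positivity
      rw [← hω, hcoef, ← ENNReal.ofReal_mul (by positivity), ← ENNReal.ofReal_mul (by positivity),
        h1, ENNReal.ofReal_lt_ofReal_iff (by positivity)]
      linarith
  let G : Set (EuclideanSpace ℝ (Fin (d + 1))) := Metric.ball x₀ r ∩ {x | t < v x}
  have hGo : IsOpen G := Metric.isOpen_ball.inter (isOpen_lt continuous_const hv.continuous)
  have hcl : closure G ⊆ Metric.closedBall x₀ r ∩ {x | t ≤ v x} := by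
    refine closure_minimal ?_
      (Metric.isClosed_closedBall.inter (isClosed_le continuous_const hv.continuous))
    exact inter_subset_inter Metric.ball_subset_closedBall
      fun x (hx : t < v x) => show t ≤ v x from hx.le
  have hclu : ∀ x ∈ closure G, 0 < u x := fun x hx => by
    have h1 := hcl hx
    have h2 := (abs_le.1 (huv x h1.1)).2
    have h3 : t ≤ v x := h1.2
    linarith [ht.1]
  -- `u` is positive on `closure G`, which therefore avoids the sphere, and the frontier of `G` lies
  -- on the level set alone.
  have hclb : ∀ x ∈ closure G, x ∈ Metric.ball x₀ r := fun x hx =>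
    hu.2.2 (subset_tsupport _ (hclu x hx).ne')
  have hfr : ∀ x ∈ frontier G, v x = t := fun x hx => by
    rw [hGo.frontier_eq] at hx
    refine le_antisymm (not_lt.1 fun h => hx.2 ⟨hclb x hx.1, h⟩) (hcl hx.1).2
  have hsub : {x | s < u x} ⊆ G := fun x (hx : s < u x) => by
    have hxb : x ∈ Metric.ball x₀ r := hu.2.2 (subset_tsupport _ (hs.trans hx).ne')
    have h2 := (abs_le.1 (huv x (Metric.ball_subset_closedBall hxb))).1
    have : t < v x := by linarith [ht.2]
    exact ⟨hxb, this⟩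
  refine ⟨G, ⟨hGo, hne.mono hsub, ?_, hclu, ?_⟩, hsub, ?_⟩
  · exact (isCompact_closedBall x₀ r).of_isClosed_subset isClosed_closure
      (hcl.trans inter_subset_left)
  · intro x hx
    have hxc := frontier_subset_closure hx
    refine ⟨Metric.ball x₀ r, Metric.isOpen_ball, hclb x hxc, fun y => t - v y,
      (contDiff_const.sub hv).contDiffOn, sub_eq_zero.2 (hfr x hx).symm, ?_, ?_⟩
    · intro hg
      have hfd : fderiv ℝ (fun y => t - v y) x = 0 := by
        rw [gradient] at hg
        exact (LinearIsometryEquiv.map_eq_zero_iff _).1 hg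
      rw [fderiv_const_sub, neg_eq_zero, hfdv] at hfd
      exact htZ ⟨x, ⟨(hcl hxc).1, hfd⟩, hfr x hx⟩
    · ext y
      simp only [G, mem_inter_iff, mem_ofPred_eq, sub_neg]
      tauto
  · refine (measure_mono fun x hx => ?_).trans htM.le
    exact ⟨(hcl (frontier_subset_closure hx)).1, hfr x hx⟩

theorem cheegerConstant_le {d : ℕ} {Ω G : Set (EuclideanSpace ℝ (Fin (d + 1)))}
    (hG : G ∈ cheegerSets Ω) :
    cheegerConstant Ω ≤
      (Measure.addHaarScalarFactor (volume : Measure (EuclideanSpace ℝ (Fin d))) μH[d] : ℝ≥0∞) *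
        μH[(d : ℝ)] (frontier G) / volume G :=
  iInf₂_le G hG

theorem cheegerSets_mono {N : ℕ} {Ω Ω' : Set (EuclideanSpace ℝ (Fin N))} (h : Ω ⊆ Ω') :
    cheegerSets Ω ⊆ cheegerSets Ω' := fun _ hG =>
  ⟨hG.1, hG.2.1, hG.2.2.1, hG.2.2.2.1.trans h, hG.2.2.2.2⟩

/-- The total variation of a cut-off of `1 - φ`. -/
theorem lintegral_enorm_fderiv_cutoff_le {E : Type*} [NormedAddCommGroup E]
    [InnerProductSpace ℝ E] [FiniteDimensional ℝ E] [MeasurableSpace E] [BorelSpace E]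
    {η φ : E → ℝ} (hη : ContDiff ℝ 1 η) (hφ : ContDiff ℝ 1 φ) {U : Set E} (hU : MeasurableSet U)
    (h01 : ∀ x, η x ∈ Icc (0 : ℝ) 1) (hηs : tsupport η ⊆ U) {l : ℝ}
    (hl : ∀ x, ‖fderiv ℝ η x‖ ≤ l) :
    ∫⁻ x, ‖fderiv ℝ (fun x => η x * (1 - φ x)) x‖ₑ
      ≤ (∫⁻ x, ‖fderiv ℝ φ x‖ₑ) + ENNReal.ofReal l * (volume U + ∫⁻ x in U, ‖φ x‖ₑ) := by
  have hl0 : 0 ≤ l := (norm_nonneg _).trans (hl 0)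
  have hpt : ∀ x, ‖fderiv ℝ (fun x => η x * (1 - φ x)) x‖ₑ
      ≤ ‖fderiv ℝ φ x‖ₑ + ENNReal.ofReal l * U.indicator (fun x => 1 + ‖φ x‖ₑ) x := by
    intro x
    have hφx := hφ.differentiable one_ne_zero x
    have h1 : fderiv ℝ (fun x => η x * (1 - φ x)) x
        = η x • (-fderiv ℝ φ x) + (1 - φ x) • fderiv ℝ η x := by
      have h := fderiv_fun_mul (hη.differentiable one_ne_zero x) (hφx.const_sub 1)
      rwa [fderiv_const_sub] at h
    have h2 : ‖η x • (-fderiv ℝ φ x)‖ ≤ ‖fderiv ℝ φ x‖ := by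
      rw [norm_smul, norm_neg, Real.norm_of_nonneg (h01 x).1]
      exact mul_le_of_le_one_left (norm_nonneg _) (h01 x).2
    by_cases hx : x ∈ U
    · rw [indicator_of_mem hx, ← ofReal_norm, ← ofReal_norm (φ x), ← ofReal_norm (fderiv ℝ φ x),
        ← ENNReal.ofReal_one, ← ENNReal.ofReal_add zero_le_one (norm_nonneg _),
        ← ENNReal.ofReal_mul hl0, ← ENNReal.ofReal_add (norm_nonneg _) (by positivity), h1]
      refine ENNReal.ofReal_le_ofReal ((norm_add_le _ _).trans (add_le_add h2 ?_))
      rw [norm_smul, mul_comm]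
      have h3 : ‖1 - φ x‖ ≤ 1 + ‖φ x‖ := (norm_sub_le _ _).trans_eq (by simp)
      exact mul_le_mul (hl x) h3 (norm_nonneg _) hl0
    · have hz : fderiv ℝ η x = 0 := by
        by_contra h
        exact hx (hηs (support_fderiv_subset ℝ h))
      rw [indicator_of_notMem hx, h1, hz, smul_zero, add_zero, mul_zero, add_zero,
        ← ofReal_norm, ← ofReal_norm (fderiv ℝ φ x)]
      exact ENNReal.ofReal_le_ofReal h2
  refine (lintegral_mono hpt).trans_eq ?_
  have hm : Measurable fun x => ‖fderiv ℝ φ x‖ₑ :=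
    (continuous_enorm.comp (hφ.continuous_fderiv one_ne_zero)).measurable
  rw [lintegral_add_left hm, lintegral_const_mul' _ _ ENNReal.ofReal_ne_top,
    lintegral_indicator hU, lintegral_add_left measurable_const, setLIntegral_one]

/-- A function with small total variation is small on a large part of the ball. -/
theorem volume_superlevel_le {d : ℕ} {φ : EuclideanSpace ℝ (Fin (d + 1)) → ℝ}
    (hφ : ContDiff ℝ 1 φ) {x₀ : EuclideanSpace ℝ (Fin (d + 1))} {r q m V : ℝ} (hq : 0 < q)
    (hm : ∫⁻ x in Metric.ball x₀ r, ‖φ x‖ₑ ≤ ENNReal.ofReal (q * m * V)) :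
    volume (Metric.ball x₀ r ∩ {x | q ≤ φ x}) ≤ ENNReal.ofReal (m * V) := by
  have hset : MeasurableSet (Metric.ball x₀ r ∩ {x | q ≤ φ x}) :=
    Metric.isOpen_ball.measurableSet.inter (measurableSet_le measurable_const
      hφ.continuous.measurable)
  have hq0 : ENNReal.ofReal q ≠ 0 := (ENNReal.ofReal_pos.2 hq).ne'
  refine (ENNReal.mul_le_mul_iff_right hq0 ENNReal.ofReal_ne_top).1 ?_
  rw [← ENNReal.ofReal_mul hq.le, ← mul_assoc, ← setLIntegral_const]
  refine le_trans ?_ hm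
  -- Chebyshev's inequality.
  refine (setLIntegral_mono' hset fun x hx => ?_).trans (lintegral_mono_set inter_subset_left)
  rw [← ofReal_norm]
  exact ENNReal.ofReal_le_ofReal ((show q ≤ φ x from hx.2).trans (le_abs_self _))

/-- If the complement of `Ω` is negligible in a ball of radius `r`, then the Cheeger constant of
`Ω` is at most a constant times `1 / r`. -/
theorem exists_cheegerConstant_le_of_isNegligible {d : ℕ} (hd : d ≠ 0) {γ : ℝ}
    (hγ : γ ∈ Ioo (0 : ℝ) 1) : ∃ C : ℝ, 0 < C ∧
    ∀ (Ω : Set (EuclideanSpace ℝ (Fin (d + 1)))) (x₀ : EuclideanSpace ℝ (Fin (d + 1))) (r : ℝ),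
      0 < r → IsNegligible 1 γ x₀ r (Metric.closedBall x₀ r \ Ω) →
      cheegerConstant Ω ≤ ENNReal.ofReal (C / r) := by
  obtain ⟨hγ0, hγ1⟩ := hγ
  have hn : (0 : ℝ) < ((d + 1 : ℕ) : ℝ) := by positivity
  set n : ℝ := ((d + 1 : ℕ) : ℝ) with hndef
  -- The gap `γ < γ'` allows an almost optimal `φ`; `γ' < g < 1` makes `{γ' / g ≤ φ}` occupy at most
  -- the fraction `g` of the ball. By Bernoulli the choice of `a` gives `a ^ (d + 1) ≥ 1 - c = g +
  -- c`, so a fraction `c` of good points remains in the smaller ball.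
  obtain ⟨γ', hγγ', hγ'1⟩ := exists_between hγ1
  obtain ⟨g, hγ'g, hg1⟩ := exists_between hγ'1
  have hγ'0 : 0 < γ' := hγ0.trans hγγ'
  have hg0 : 0 < g := hγ'0.trans hγ'g
  set s := 1 - γ' / g with hs
  have hs0 : 0 < s := sub_pos.2 ((div_lt_one hg0).2 hγ'g)
  set c := (1 - g) / 2 with hc
  have hc0 : 0 < c := by linarith
  set a := 1 - c / n with ha
  have hn1 : 1 ≤ n := by simp [hndef]
  have hcn : c / n < 1 := by rw [div_lt_one hn]; linarith
  have ha0 : 0 < a := by linarith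
  have ha1 : a < 1 := sub_lt_self _ (by positivity)
  have han : g + c ≤ a ^ (d + 1) := by
    have h := one_add_mul_le_pow (a := -(c / n)) (by linarith) (d + 1)
    rw [← hndef, ← sub_eq_add_neg, mul_neg, mul_div_cancel₀ _ hn.ne'] at h
    linarith
  obtain ⟨L, hL, hcut⟩ := exists_cutoff (EuclideanSpace ℝ (Fin (d + 1))) ha0 ha1
  obtain ⟨K, hK, hlevel⟩ := exists_smooth_superlevel hd
  set κ := Measure.addHaarScalarFactor (volume : Measure (EuclideanSpace ℝ (Fin d))) μH[d] with hκ
  have hκ0 : κ ≠ 0 := Measure.addHaarScalarFactor_volume_hausdorffMeasure_ne_zero d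
  have hκpos : (0 : ℝ) < κ := by exact_mod_cast pos_iff_ne_zero.2 hκ0
  refine ⟨κ * (K * (γ' * n + L * (1 + γ'))) / (s * c), by positivity,
    fun Ω x₀ r hr hneg => ?_⟩
  set V := (volume (Metric.ball x₀ r)).toReal with hV
  have hVe : volume (Metric.ball x₀ r) = ENNReal.ofReal V :=
    (ENNReal.ofReal_toReal measure_ball_lt_top.ne).symm
  have hV0 : 0 < V := ENNReal.toReal_pos (Metric.measure_ball_pos _ _ hr).ne'
    measure_ball_lt_top.ne
  have hcap : relCap 1 (Metric.closedBall x₀ r \ Ω) (Metric.ball x₀ (2 * r))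
      < ENNReal.ofReal (n / r * (γ' * V)) := by
    refine hneg.2.2.trans_lt ?_
    have h1 := relCap_closedBall_le x₀ hr (show r < 2 * r by linarith)
    refine (mul_le_mul_right h1 _).trans_lt ?_
    rw [hVe, ← ENNReal.ofReal_mul (by positivity), ← ENNReal.ofReal_mul (by positivity),
      ENNReal.ofReal_lt_ofReal_iff (by positivity)]
    have : 0 < n / r * V := by positivity
    calc γ * (n / r * V) < γ' * (n / r * V) := by gcongr
      _ = _ := by ring
  rw [relCap_one] at hcap
  simp only [iInf_lt_iff] at hcap
  obtain ⟨φ, ⟨hφ, hφ1⟩, hφD⟩ := hcap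
  have hφc : ContDiff ℝ 1 φ := contDiff_one_of_mem_testFunctions hφ
  -- The sharp constant `n / r` cancels exactly, so the mean of `|φ|` is at most `γ' < 1`.
  have hJ : ∫⁻ x in Metric.ball x₀ r, ‖φ x‖ₑ ≤ ENNReal.ofReal (γ' * V) := by
    have h := (mul_setLIntegral_ball_le hφc hφ.2.1 x₀ hr).trans hφD.le
    rw [finrank_euclideanSpace_fin, ENNReal.ofReal_mul (p := n / r) (by positivity)] at h
    exact (ENNReal.mul_le_mul_iff_right (ENNReal.ofReal_pos.2 (by positivity)).ne'
      ENNReal.ofReal_ne_top).1 h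
  obtain ⟨η, hη, h01, hη1, hηc, hηs, hηL⟩ := hcut x₀ r hr
  rw [one_mul] at hηs
  let u : EuclideanSpace ℝ (Fin (d + 1)) → ℝ := fun x => η x * (1 - φ x)
  have hus : tsupport u ⊆ tsupport η := tsupport_mul_subset_left
  have hu : u ∈ testFunctions (Metric.ball x₀ r) :=
    ⟨hη.mul (contDiff_const.sub hφ.1), hηc.of_isClosed_subset (isClosed_tsupport _) hus,
      hus.trans hηs⟩
  -- Where `u > 0` one is inside the ball with `φ < 1`, whereas `φ ≥ 1` on the part of the ball
  -- outside `Ω`.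
  have hupos : {x | 0 < u x} ⊆ Ω := by
    intro x hx
    have hx' : 0 < η x * (1 - φ x) := hx
    by_contra hxΩ
    have hxb : x ∈ Metric.closedBall x₀ r :=
      Metric.ball_subset_closedBall (hu.2.2 (subset_tsupport _ hx'.ne'))
    nlinarith [hφ1 x ⟨hxb, hxΩ⟩, (h01 x).1]
  have hgrad : ∫⁻ x, ‖fderiv ℝ u x‖ₑ ≤ ENNReal.ofReal ((γ' * n + L * (1 + γ')) * (V / r)) := by
    refine (lintegral_enorm_fderiv_cutoff_le (hη.of_le (by exact_mod_cast le_top)) hφc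
      Metric.isOpen_ball.measurableSet h01 hηs hηL).trans ?_
    calc (∫⁻ x, ‖fderiv ℝ φ x‖ₑ) + ENNReal.ofReal (L / r) *
          (volume (Metric.ball x₀ r) + ∫⁻ x in Metric.ball x₀ r, ‖φ x‖ₑ)
        ≤ ENNReal.ofReal (n / r * (γ' * V)) + ENNReal.ofReal (L / r) *
          (ENNReal.ofReal V + ENNReal.ofReal (γ' * V)) := by
          rw [hVe]
          gcongr
      _ = _ := by
          rw [← ENNReal.ofReal_add (by positivity) (by positivity),
            ← ENNReal.ofReal_mul (by positivity),
            ← ENNReal.ofReal_add (by positivity) (by positivity)]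
          congr 1
          ring
  have hvol : ENNReal.ofReal (c * V) ≤ volume {x | s < u x} := by
    have hbad : volume (Metric.ball x₀ r ∩ {x | γ' / g ≤ φ x}) ≤ ENNReal.ofReal (g * V) := by
      refine volume_superlevel_le hφc (by positivity) ?_
      rwa [div_mul_cancel₀ _ hg0.ne']
    have hsub : Metric.ball x₀ (a * r)
        ⊆ {x | s < u x} ∪ (Metric.ball x₀ r ∩ {x | γ' / g ≤ φ x}) := by
      intro x hx
      by_cases hxφ : γ' / g ≤ φ x
      · exact Or.inr ⟨Metric.ball_subset_ball (by nlinarith) hx, hxφ⟩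
      · refine Or.inl (show s < η x * (1 - φ x) from ?_)
        rw [hη1 x (Metric.ball_subset_closedBall hx), one_mul, hs]
        linarith
    have hball : ENNReal.ofReal (g * V) + ENNReal.ofReal (c * V)
        ≤ volume (Metric.ball x₀ (a * r)) := by
      rw [Measure.addHaar_ball_mul_of_pos _ _ ha0, finrank_euclideanSpace_fin,
        ← Measure.addHaar_ball_center volume x₀ r, hVe,
        ← ENNReal.ofReal_add (by positivity) (by positivity), ← ENNReal.ofReal_mul (by positivity),
        ← add_mul]
      exact ENNReal.ofReal_le_ofReal (by gcongr)
    have h := hball.trans ((measure_mono hsub).trans (measure_union_le _ _))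
    rw [add_comm (volume _)] at h
    exact (ENNReal.add_le_add_iff_left ENNReal.ofReal_ne_top).1
      (h.trans (add_le_add_left hbad _))
  have hcV : 0 < c * V := by positivity
  have hne : {x | s < u x}.Nonempty := by
    refine nonempty_of_measure_ne_zero (μ := volume) ?_
    exact ((ENNReal.ofReal_pos.2 hcV).trans_le hvol).ne'
  obtain ⟨G, hG, hsG, hGH⟩ := hlevel u x₀ r s _ hr hs0 (by positivity) hu hgrad hne
  refine (cheegerConstant_le (cheegerSets_mono hupos hG)).trans ?_
  calc (κ : ℝ≥0∞) * μH[(d : ℝ)] (frontier G) / volume G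
      ≤ ENNReal.ofReal κ * ENNReal.ofReal
          (K * ((γ' * n + L * (1 + γ')) * (V / r)) / s) / ENNReal.ofReal (c * V) := by
        rw [ENNReal.ofReal_coe_nnreal]
        gcongr
        exact hvol.trans (measure_mono hsG)
    _ = _ := by
        rw [← ENNReal.ofReal_mul hκpos.le, ← ENNReal.ofReal_div_of_pos hcV]
        congr 1
        field_simp

/-- The Cheeger constant is bounded from above by the inverse of the capacitary inradius. -/
theorem exists_cheegerConstant_le_div_capInradius {N : ℕ} (hN : 2 ≤ N) {γ : ℝ}
    (hγ : γ ∈ Ioo (0 : ℝ) 1) : ∃ C : ℝ, 0 < C ∧ ∀ Ω : Set (EuclideanSpace ℝ (Fin N)),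
      cheegerConstant Ω ≤ ENNReal.ofReal C / capInradius 1 γ Ω := by
  obtain ⟨d, rfl⟩ : ∃ d, N = d + 1 := ⟨N - 1, by omega⟩
  obtain ⟨C, hC, h⟩ := exists_cheegerConstant_le_of_isNegligible (show d ≠ 0 by omega) hγ
  refine ⟨C, hC, fun Ω => ?_⟩
  rw [ENNReal.le_div_iff_mul_le (Or.inr (ENNReal.ofReal_pos.2 hC).ne')
    (Or.inr ENNReal.ofReal_ne_top), capInradius]
  simp_rw [ENNReal.mul_iSup]
  refine iSup₂_le fun r ⟨hr, x₀, hx₀⟩ => ?_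
  calc cheegerConstant Ω * ENNReal.ofReal r ≤ ENNReal.ofReal (C / r) * ENNReal.ofReal r := by
        gcongr
        exact h Ω x₀ r hr hx₀
    _ = ENNReal.ofReal C := by
        rw [← ENNReal.ofReal_mul (by positivity), div_mul_cancel₀ _ hr.ne']

end CheegerUpperBound

/-! ### Thin shells, and divergence of the constant -/

section Annulus

/-- A Poincaré inequality on thin spherical shells. -/
theorem lintegral_le_of_tsupport_subset_shell {E : Type*} [NormedAddCommGroup E]
    [InnerProductSpace ℝ E] [FiniteDimensional ℝ E] [MeasurableSpace E] [BorelSpace E]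
    [Nontrivial E] {ρ ρ' : ℝ} (hρ : 0 < ρ) (hρρ' : ρ < ρ') {u : E → ℝ} (hu : ContDiff ℝ 1 u)
    (hc : HasCompactSupport u) (hs : tsupport u ⊆ {x | ρ < ‖x‖ ∧ ‖x‖ < ρ'}) :
    ∫⁻ x, ‖u x‖ₑ ≤ ENNReal.ofReal (ρ' - ρ) * ∫⁻ x, ‖fderiv ℝ u x‖ₑ := by
  have hρ' : 0 < ρ' := hρ.trans hρρ'
  have hdim : (1 : ℝ) ≤ Module.finrank ℝ E := by
    exact_mod_cast Module.finrank_pos (R := ℝ) (M := E)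
  have hid := integral_abs_mul_radialDiv hu hc hρ
  have hid' := integral_abs_mul_radialDiv hu hc hρ'
  have hi1 := integrable_abs_mul_radialDiv hu.continuous hc hρ
  have hi1' := integrable_abs_mul_radialDiv hu.continuous hc hρ'
  have hi2 := integrable_sign_mul_fderiv hu hc (lipschitzWith_radialField (E := E) hρ).continuous
  have hi2' := integrable_sign_mul_fderiv hu hc (lipschitzWith_radialField (E := E) hρ').continuous
  have hui : Integrable u := hu.continuous.integrable_of_hasCompactSupport hc
  -- The calibration is `ρ'` times the field of radius `ρ'` minus `ρ` times that of radius `ρ`. On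
  -- the shell it equals `(1 - ρ / ‖x‖) x`, of norm at most `ρ' - ρ` and divergence `N - ρ (N - 1) /
  -- ‖x‖ ≥ 1`.
  have hreal : ∫ x, |u x| ≤ ∫ x, (ρ' - ρ) * ‖fderiv ℝ u x‖ := by
    calc ∫ x, |u x|
        ≤ ∫ x, (ρ' * (|u x| * radialDiv E ρ' x) - ρ * (|u x| * radialDiv E ρ x)) := by
          refine integral_mono hui.abs ((hi1'.const_mul ρ').sub (hi1.const_mul ρ)) fun x => ?_
          by_cases hx : x ∈ tsupport u
          · obtain ⟨h1, h2⟩ := hs hx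
            have hx0 : 0 < ‖x‖ := hρ.trans h1
            simp only [radialDiv, if_pos h2, if_neg h1.not_gt]
            have h3 : ρ * ((Module.finrank ℝ E - 1) / ‖x‖) ≤ Module.finrank ℝ E - 1 := by
              rw [← mul_div_assoc, div_le_iff₀ hx0]
              nlinarith
            have h4 : ρ' * (Module.finrank ℝ E / ρ') = (Module.finrank ℝ E : ℝ) := by field_simp
            have h5 : ρ' * (|u x| * (Module.finrank ℝ E / ρ'))
                - ρ * (|u x| * ((Module.finrank ℝ E - 1) / ‖x‖))
                = |u x| * (ρ' * (Module.finrank ℝ E / ρ')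
                  - ρ * ((Module.finrank ℝ E - 1) / ‖x‖)) := by ring
            rw [h5, h4]
            exact le_mul_of_one_le_right (abs_nonneg _) (by linarith)
          · simp [image_eq_zero_of_notMem_tsupport hx]
      _ = ∫ x, (ρ * (SignType.sign (u x) * fderiv ℝ u x (radialField ρ x))
            - ρ' * (SignType.sign (u x) * fderiv ℝ u x (radialField ρ' x))) := by
          rw [integral_sub (hi1'.const_mul ρ') (hi1.const_mul ρ),
            integral_sub (hi2.const_mul ρ) (hi2'.const_mul ρ'), integral_const_mul,
            integral_const_mul, integral_const_mul, integral_const_mul, hid, hid']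
          ring
      _ ≤ ∫ x, (ρ' - ρ) * ‖fderiv ℝ u x‖ := by
          refine integral_mono ((hi2.const_mul ρ).sub (hi2'.const_mul ρ'))
            ((integrable_norm_fderiv hu hc).const_mul _) fun x => ?_
          by_cases hx : x ∈ tsupport u
          · obtain ⟨h1, h2⟩ := hs hx
            have hx0 : 0 < ‖x‖ := hρ.trans h1
            have hfield : ρ * (SignType.sign (u x) * fderiv ℝ u x (radialField ρ x))
                - ρ' * (SignType.sign (u x) * fderiv ℝ u x (radialField ρ' x))
                = SignType.sign (u x) * fderiv ℝ u x ((ρ / ‖x‖ - 1) • x) := by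
              simp only [radialField, max_eq_right h1.le, max_eq_left h2.le, map_smul, smul_eq_mul]
              field_simp
            simp only [hfield]
            refine (le_abs_self _).trans ((abs_sign_mul_le _ _).trans ?_)
            refine ((fderiv ℝ u x).le_opNorm _).trans ?_
            rw [mul_comm]
            gcongr
            rw [norm_smul, Real.norm_eq_abs, abs_of_nonpos (by
              rw [sub_nonpos, div_le_one hx0]; exact h1.le), neg_sub, sub_mul, one_mul,
              div_mul_cancel₀ _ hx0.ne']
            linarith
          · have hz : fderiv ℝ u x = 0 := by
              by_contra h
              exact hx (support_fderiv_subset ℝ h)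
            simp [hz]
  rw [integral_const_mul] at hreal
  have h1 := ENNReal.ofReal_le_ofReal hreal
  rw [ENNReal.ofReal_mul (by linarith), ofReal_integral_eq_lintegral_ofReal hui.abs
      (Eventually.of_forall fun x => abs_nonneg _),
    ofReal_integral_eq_lintegral_ofReal (integrable_norm_fderiv hu hc)
      (Eventually.of_forall fun x => norm_nonneg _)] at h1
  simp_rw [← Real.norm_eq_abs, ofReal_norm] at h1
  exact h1

theorem relCap_mono {N : ℕ} (p : ℝ) {S T : Set (EuclideanSpace ℝ (Fin N))} (h : S ⊆ T)
    (U : Set (EuclideanSpace ℝ (Fin N))) : relCap p S U ≤ relCap p T U :=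
  biInf_mono fun _ hφ => ⟨hφ.1, fun x hx => hφ.2 x (h hx)⟩

/-- The capacitary inradius of a thin shell around the unit sphere is at least `1`. -/
theorem one_le_capInradius_shell {N : ℕ} (hN : 2 ≤ N) {γ : ℝ} (hγ : γ ∈ Ioo (0 : ℝ) 1) :
    1 ≤ capInradius 1 γ {x : EuclideanSpace ℝ (Fin N) | γ < ‖x‖ ∧ ‖x‖ < 2 - γ} := by
  have : NeZero N := ⟨by omega⟩
  obtain ⟨hγ0, hγ1⟩ := hγ
  have hopen : IsOpen {x : EuclideanSpace ℝ (Fin N) | γ < ‖x‖ ∧ ‖x‖ < 2 - γ} :=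
    (isOpen_lt continuous_const continuous_norm).inter
      (isOpen_lt continuous_norm continuous_const)
  rw [← ENNReal.ofReal_one]
  refine le_iSup₂_of_le (f := fun (r : ℝ) _ => ENNReal.ofReal r) 1 ⟨one_pos, 0,
    (isCompact_closedBall _ _).diff hopen, sdiff_subset, ?_⟩ le_rfl
  have hsub : Metric.closedBall (0 : EuclideanSpace ℝ (Fin N)) 1
      \ {x | γ < ‖x‖ ∧ ‖x‖ < 2 - γ} ⊆ Metric.closedBall 0 γ := by
    rintro x ⟨hx1, hx2⟩
    rw [mem_closedBall_zero_iff] at hx1 ⊢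
    by_contra hx
    exact hx2 ⟨not_le.1 hx, by linarith⟩
  set ω := volume (Metric.ball (0 : EuclideanSpace ℝ (Fin N)) 1) with hω
  calc relCap 1 (Metric.closedBall (0 : EuclideanSpace ℝ (Fin N)) 1
        \ {x | γ < ‖x‖ ∧ ‖x‖ < 2 - γ}) (Metric.ball 0 (2 * 1))
      ≤ ENNReal.ofReal (N / γ) * volume (Metric.ball (0 : EuclideanSpace ℝ (Fin N)) γ) :=
        (relCap_mono 1 hsub _).trans (relCap_closedBall_le 0 hγ0 (by linarith))
    _ = ENNReal.ofReal (N / γ * γ ^ N) * ω := by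
        rw [Measure.addHaar_ball _ _ hγ0.le, finrank_euclideanSpace_fin, ← mul_assoc,
          ← ENNReal.ofReal_mul (by positivity)]
    _ ≤ ENNReal.ofReal (γ * (N / 1)) * ω := by
        gcongr ENNReal.ofReal ?_ * ω
        -- The capacity ratio of the balls of radii `γ` and `1` is `γ ^ (N - 1)`; here `2 ≤ N` gives
        -- at most `γ`.
        have h2 : γ ^ N ≤ γ ^ 2 := pow_le_pow_of_le_one hγ0.le hγ1.le hN
        calc N / γ * γ ^ N ≤ N / γ * γ ^ 2 := by gcongr
          _ = γ * (N / 1) := by field_simp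
    _ = ENNReal.ofReal γ * (ENNReal.ofReal (N / 1) * ω) := by
        rw [ENNReal.ofReal_mul hγ0.le, mul_assoc]
    _ ≤ _ := by
        gcongr
        exact mul_volume_ball_le_relCap 0 one_pos _

/-- Any admissible constant in the upper bound blows up as `γ` tends to `1`. -/
theorem tendsto_atTop_of_cheegerConstant_le {N : ℕ} (hN : 2 ≤ N) {C : ℝ → ℝ}
    (hC : ∀ γ ∈ Ioo (0 : ℝ) 1, ∀ Ω : Set (EuclideanSpace ℝ (Fin N)), IsOpen Ω →
      cheegerConstant Ω ≤ ENNReal.ofReal (C γ) / capInradius 1 γ Ω) :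
    Tendsto C (𝓝[<] 1) atTop := by
  have : NeZero N := ⟨by omega⟩
  obtain ⟨K, hK, h⟩ := exists_cheegerConstant_lower_bound hN
  -- The shell of width `2 * (1 - γ)` has `h ≥ K / (2 * (1 - γ))`, while its inradius is at least
  -- `1`.
  have hle : ∀ γ ∈ Ioo (0 : ℝ) 1, K / 2 * (1 - γ)⁻¹ ≤ C γ := by
    intro γ hγ
    have hopen : IsOpen {x : EuclideanSpace ℝ (Fin N) | γ < ‖x‖ ∧ ‖x‖ < 2 - γ} :=
      (isOpen_lt continuous_const continuous_norm).inter
        (isOpen_lt continuous_norm continuous_const)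
    have hpos : 0 < 2 - γ - γ := by linarith [hγ.2]
    have h1 := h {x : EuclideanSpace ℝ (Fin N) | γ < ‖x‖ ∧ ‖x‖ < 2 - γ} (2 - γ - γ) hpos
      fun u hu => lintegral_le_of_tsupport_subset_shell hγ.1 (by linarith)
        (contDiff_one_of_mem_testFunctions hu) hu.2.1 hu.2.2
    have h2 : ENNReal.ofReal (K / (2 - γ - γ)) ≤ ENNReal.ofReal (C γ) := by
      refine h1.trans ((hC γ hγ _ hopen).trans ?_)
      exact (ENNReal.div_le_div_left (one_le_capInradius_shell hN hγ) _).trans_eq (div_one _)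
    have h3 : K / (2 - γ - γ) = K / 2 * (1 - γ)⁻¹ := by
      have : 1 - γ ≠ 0 := by linarith [hγ.2]
      rw [show 2 - γ - γ = 2 * (1 - γ) by ring]
      field_simp
    rw [← h3]
    rcases ENNReal.ofReal_le_ofReal_iff'.1 h2 with h4 | h4
    · exact h4
    · exact absurd h4 (not_le.2 (by positivity))
  have hlim : Tendsto (fun γ : ℝ => K / 2 * (1 - γ)⁻¹) (𝓝[<] 1) atTop := by
    refine Tendsto.const_mul_atTop (by positivity) (tendsto_inv_nhdsGT_zero.comp ?_)
    refine tendsto_nhdsWithin_iff.2 ⟨?_, ?_⟩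
    · have : Tendsto (fun γ : ℝ => 1 - γ) (𝓝 1) (𝓝 (1 - 1)) :=
        (continuous_const.sub continuous_id).tendsto 1
      rw [sub_self] at this
      exact this.mono_left nhdsWithin_le_nhds
    · filter_upwards [self_mem_nhdsWithin] with γ hγ
      exact sub_pos.2 (mem_Iio.1 hγ)
  exact tendsto_atTop_mono' _ (mem_of_superset (Ioo_mem_nhdsLT zero_lt_one) hle) hlim

end Annulus

end CapacitaryInradius

/-! ### The two-sided estimate and its consequences -/

theorem corollary1 (N : ℕ) (hN : 2 ≤ N) :
    ∃ σ : ℝ, 0 < σ ∧ ∃ C : ℝ → ℝ, (∀ γ ∈ Ioo (0 : ℝ) 1, 0 < C γ) ∧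
      -- the two-sided estimate
      (∀ γ ∈ Ioo (0 : ℝ) 1, ∀ Ω : Set (EuclideanSpace ℝ (Fin N)), IsOpen Ω →
        ENNReal.ofReal (σ * γ) / CapacitaryInradius.capInradius 1 γ Ω
            ≤ CapacitaryInradius.cheegerConstant Ω ∧
        CapacitaryInradius.cheegerConstant Ω
            ≤ ENNReal.ofReal (C γ) / CapacitaryInradius.capInradius 1 γ Ω) ∧
      -- the constant of the upper bound diverges as `γ` goes to `1` ...
      Tendsto C (𝓝[<] 1) atTop ∧
      -- ... and so does every constant for which the upper bound holds
      (∀ C' : ℝ → ℝ,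
        (∀ γ ∈ Ioo (0 : ℝ) 1, ∀ Ω : Set (EuclideanSpace ℝ (Fin N)), IsOpen Ω →
          CapacitaryInradius.cheegerConstant Ω
            ≤ ENNReal.ofReal (C' γ) / CapacitaryInradius.capInradius 1 γ Ω) →
        Tendsto C' (𝓝[<] 1) atTop) ∧
      -- positivity of the Cheeger constant
      (∀ γ ∈ Ioo (0 : ℝ) 1, ∀ Ω : Set (EuclideanSpace ℝ (Fin N)), IsOpen Ω →
        (0 < CapacitaryInradius.cheegerConstant Ω ↔
          CapacitaryInradius.capInradius 1 γ Ω < ⊤)) ∧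
      -- finiteness of the capacitary inradius does not depend on `γ`
      (∀ γ ∈ Ioo (0 : ℝ) 1, ∀ γ' ∈ Ioo (0 : ℝ) 1,
        ∀ Ω : Set (EuclideanSpace ℝ (Fin N)), IsOpen Ω →
          (CapacitaryInradius.capInradius 1 γ Ω < ⊤ ↔
            CapacitaryInradius.capInradius 1 γ' Ω < ⊤)) := by
  obtain ⟨σ, hσ, hlower⟩ := CapacitaryInradius.exists_div_capInradius_le_cheegerConstant hN
  -- Stated for all real `γ`, with the default `0` outside `(0, 1)`, so that `C` can be chosen as a
  -- function on `ℝ`.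
  have hupper : ∀ γ : ℝ, ∃ C : ℝ, γ ∈ Ioo (0 : ℝ) 1 → 0 < C ∧
      ∀ Ω : Set (EuclideanSpace ℝ (Fin N)), CapacitaryInradius.cheegerConstant Ω
        ≤ ENNReal.ofReal C / CapacitaryInradius.capInradius 1 γ Ω := fun γ => by
    by_cases hγ : γ ∈ Ioo (0 : ℝ) 1
    · obtain ⟨C, hC⟩ := CapacitaryInradius.exists_cheegerConstant_le_div_capInradius hN hγ
      exact ⟨C, fun _ => hC⟩
    · exact ⟨0, fun h => absurd h hγ⟩
  choose C hC using hupper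
  have hpos : ∀ γ ∈ Ioo (0 : ℝ) 1, ∀ Ω : Set (EuclideanSpace ℝ (Fin N)), IsOpen Ω →
      (0 < CapacitaryInradius.cheegerConstant Ω ↔ CapacitaryInradius.capInradius 1 γ Ω < ⊤) := by
    intro γ hγ Ω hΩ
    constructor
    · intro h
      rw [lt_top_iff_ne_top]
      intro htop
      have h2 := (hC γ hγ).2 Ω
      rw [htop, ENNReal.div_top] at h2
      exact h.not_ge h2
    · intro h
      refine lt_of_lt_of_le ?_ (hlower γ hγ Ω hΩ)
      exact ENNReal.div_pos (ENNReal.ofReal_pos.2 (mul_pos hσ hγ.1)).ne' h.ne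
  exact ⟨σ, hσ, C, fun γ hγ => (hC γ hγ).1,
    fun γ hγ Ω hΩ => ⟨hlower γ hγ Ω hΩ, (hC γ hγ).2 Ω⟩,
    -- The chosen `C` is itself admissible, so its divergence is an instance of the necessity
    -- statement.
    CapacitaryInradius.tendsto_atTop_of_cheegerConstant_le hN fun γ hγ Ω _ => (hC γ hγ).2 Ω,
    fun C' hC' => CapacitaryInradius.tendsto_atTop_of_cheegerConstant_le hN hC',
    hpos, fun γ hγ γ' hγ' Ω hΩ => (hpos γ hγ Ω hΩ).symm.trans (hpos γ' hγ' Ω hΩ)⟩
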